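/- Let $\mathbb H^n$ be hyperbolic $n$-space in the Poincaré ball model, i.e. the open unit ball of $\mathbb R^n$ with the hyperbolic distance $d$ of curvature $-1$, $\sinh\frac{d(x,y)}2=\frac{|x-y|}{\sqrt{(1-|x|^2)(1-|y|^2)}}$, and let $\partial\mathbb H^n$ be the unit sphere, on which $\mathrm{Iso}(\mathbb H^n)$ acts by continuous extension. The spherical metric on $\partial\mathbb H^n$ is $d_1(\xi,\eta)=$ the angle between the vectors $\xi$ and $\eta$. Let $\mathcal P\le\mathrm{Iso}(\mathbb H^n)$ be a discrete subgroup (for the compact-open topology) that is parabolic, i.e. there is a unique point of $\partial\mathbb H^n$ fixed by every element of $\mathcal P$. Let $\xi\in\partial\mathbb H^n$ be a point that is not fixed by $\mathcal P$ (that is, $p\xi\neq\xi$ for some $p\in\mathcal P$), and let $o\in\mathbb H^n$. Let $$\delta_{\mathcal P}=\inf\Big\{s\in\mathbb R:\ \sum_{p\in\mathcal P}e^{-s\,d(o,po)}<\infty\Big\}$$ be the critical exponent of the Poincaré series of $\mathcal P$ (it does not depend on $o$). For $F\subset\partial\mathbb H^n$ and $r>0$ let $N_r(F)$ be the smallest number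 of sets of $d_1$-diameter at most $r$ needed to cover $F$. Then the box dimension of the orbit $\mathcal P\xi=\bigcup_{p\in\mathcal P}\{p\xi\}$ exists and equals $\delta_{\mathcal P}$: $$\liminf_{r\to0^+}\frac{\log N_r(\mathcal P\xi)}{-\log r}=\limsup_{r\to0^+}\frac{\log N_r(\mathcal P\xi)}{-\log r}=\delta_{\mathcal P}.$$ -/

import Mathlib

open Filter Topology

noncomputable section

/-! ### Hyperbolic space: the Poincaré ball model -/

/-- Hyperbolic `n`-space: the points of the open unit ball of Euclidean `n`-space. -/
@[ext]
structure HypSpace (n : ℕ) where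
  /-- The underlying point of the open unit ball. -/
  pt : EuclideanSpace ℝ (Fin n)
  norm_lt : ‖pt‖ < 1

namespace HypSpace

variable {n : ℕ}

/-- The positive quantity `1 - |x|²`. -/
def ht (x : HypSpace n) : ℝ := 1 - ‖x.pt‖ ^ 2

lemma ht_pos (x : HypSpace n) : 0 < x.ht := by
  have h := x.norm_lt
  have h0 := norm_nonneg x.pt
  unfold ht
  nlinarith

/-- The hyperbolic distance (of the metric `4|dx|² / (1 - |x|²)²`, of curvature `-1`), given by
`sinh (d(x, y) / 2) = |x - y| / √((1 - |x|²) (1 - |y|²))`. -/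
def hdist (x y : HypSpace n) : ℝ :=
  2 * Real.arsinh (dist x.pt y.pt / √(x.ht * y.ht))

lemma sinh_half_hdist (x y : HypSpace n) :
    Real.sinh (hdist x y / 2) = dist x.pt y.pt / √(x.ht * y.ht) := by
  rw [hdist, mul_div_cancel_left₀ _ two_ne_zero, Real.sinh_arsinh]

lemma cosh_half_hdist (x y : HypSpace n) :
    Real.cosh (hdist x y / 2) = √(x.ht * y.ht + dist x.pt y.pt ^ 2) / √(x.ht * y.ht) := by
  have hx := x.ht_pos
  have hy := y.ht_pos
  rw [← sq_eq_sq₀ (Real.cosh_pos _).le (by positivity), Real.cosh_sq', sinh_half_hdist, div_pow,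
    div_pow, Real.sq_sqrt (by positivity), Real.sq_sqrt (by positivity)]
  field_simp

lemma ht_mul_add (x y : HypSpace n) :
    x.ht * y.ht + dist x.pt y.pt ^ 2 =
      1 - 2 * inner ℝ x.pt y.pt + ‖x.pt‖ ^ 2 * ‖y.pt‖ ^ 2 := by
  rw [dist_eq_norm, norm_sub_sq_real, ht, ht]
  ring

lemma ptolemy (x y z : HypSpace n) :
    dist x.pt z.pt * y.ht ≤ dist x.pt y.pt * √(y.ht * z.ht + dist y.pt z.pt ^ 2) +
      √(x.ht * y.ht + dist x.pt y.pt ^ 2) * dist y.pt z.pt := by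
  by_cases hy : y.pt = 0
  · rw [ht_mul_add, ht_mul_add]
    simp only [hy, ht, inner_zero_left, inner_zero_right, norm_zero, dist_zero_left,
      dist_zero_right]
    norm_num
    exact dist_le_norm_add_norm _ _
  have hpos : 0 < ‖y.pt‖ := norm_pos_iff.2 hy
  set w : EuclideanSpace ℝ (Fin n) := (‖y.pt‖ ^ 2)⁻¹ • y.pt with hw
  have key : ∀ u : HypSpace n,
      √(u.ht * y.ht + dist u.pt y.pt ^ 2) = ‖y.pt‖ * dist u.pt w := by
    intro u
    rw [ht_mul_add, Real.sqrt_eq_iff_mul_self_eq_of_pos, ← sq, mul_pow, dist_eq_norm,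
      norm_sub_sq_real, hw, inner_smul_right, norm_smul, norm_inv, norm_pow, norm_norm]
    · field_simp
      ring
    · have h1 : u.pt ≠ w := by
        intro h
        have h2 : ‖u.pt‖ = ‖y.pt‖⁻¹ := by
          rw [h, hw, norm_smul, norm_inv, norm_pow, norm_norm]
          field_simp
        have h3 := u.norm_lt
        rw [h2] at h3
        have h4 := (one_lt_inv₀ hpos).2 y.norm_lt
        linarith
      have h2 := dist_pos.2 h1
      positivity
  have hyw : y.ht = ‖y.pt‖ * dist y.pt w := by
    rw [← key y, dist_self]
    have := y.ht_pos
    rw [zero_pow two_ne_zero, add_zero, Real.sqrt_mul_self this.le]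
  have hz : √(y.ht * z.ht + dist y.pt z.pt ^ 2) = ‖y.pt‖ * dist z.pt w := by
    rw [← key z, mul_comm, dist_comm]
  rw [hz, key x, hyw]
  have h := EuclideanGeometry.mul_dist_le_mul_dist_add_mul_dist x.pt y.pt z.pt w
  nlinarith [mul_le_mul_of_nonneg_left h hpos.le]

lemma hdist_triangle (x y z : HypSpace n) : hdist x z ≤ hdist x y + hdist y z := by
  have hx := x.ht_pos
  have hy := y.ht_pos
  have hz := z.ht_pos
  have h : Real.sinh (hdist x z / 2) ≤ Real.sinh (hdist x y / 2 + hdist y z / 2) := by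
    rw [Real.sinh_add, sinh_half_hdist, sinh_half_hdist, sinh_half_hdist, cosh_half_hdist,
      cosh_half_hdist, div_mul_div_comm, div_mul_div_comm, ← add_div]
    have e : √(x.ht * y.ht) * √(y.ht * z.ht) = y.ht * √(x.ht * z.ht) := by
      rw [Real.sqrt_mul hx.le, Real.sqrt_mul hy.le, Real.sqrt_mul hx.le]
      have h2 := Real.mul_self_sqrt hy.le
      linear_combination √x.ht * √z.ht * h2
    rw [e, div_le_div_iff₀ (by positivity) (by positivity)]
    have hp := mul_le_mul_of_nonneg_right (ptolemy x y z) (Real.sqrt_nonneg (x.ht * z.ht))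
    nlinarith [hp]
  have := Real.sinh_le_sinh.1 h
  linarith

instance : MetricSpace (HypSpace n) where
  dist := hdist
  dist_self x := by simp [hdist]
  dist_comm x y := by rw [hdist, hdist, dist_comm, mul_comm x.ht]
  dist_triangle := hdist_triangle
  eq_of_dist_eq_zero {x y} h := by
    have hx := x.ht_pos
    have hy := y.ht_pos
    have h1 := sinh_half_hdist x y
    have h2 : hdist x y = 0 := h
    have h3 : √(x.ht * y.ht) ≠ 0 := by positivity
    rw [h2, zero_div, Real.sinh_zero, eq_comm, div_eq_zero_iff, or_iff_left h3] at h1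
    exact HypSpace.ext (dist_eq_zero.1 h1)

lemma dist_def (x y : HypSpace n) :
    dist x y = 2 * Real.arsinh (dist x.pt y.pt / √((1 - ‖x.pt‖ ^ 2) * (1 - ‖y.pt‖ ^ 2))) := rfl

/-- The isometry group of hyperbolic space, with its usual compact-open topology. -/
instance : TopologicalSpace (HypSpace n ≃ᵢ HypSpace n) :=
  TopologicalSpace.induced (fun g => (⟨g, g.continuous⟩ : C(HypSpace n, HypSpace n))) inferInstance

/-! ### The sphere at infinity -/

/-- The centre of the ball. -/
def center : HypSpace n := ⟨0, by simp⟩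

lemma ht_eq (x : HypSpace n) : x.ht = (Real.cosh (dist center x / 2) ^ 2)⁻¹ := by
  have hx := x.ht_pos
  have h : Real.cosh (dist center x / 2) = √(_) / √(_) := cosh_half_hdist center x
  rw [h, div_pow, Real.sq_sqrt (by have := (center (n := n)).ht_pos; positivity),
    Real.sq_sqrt (by have := (center (n := n)).ht_pos; positivity)]
  simp [center, ht]

lemma exists_ht_le (g : HypSpace n ≃ᵢ HypSpace n) :
    ∃ K : ℝ, 0 < K ∧ ∀ x, (g x).ht ≤ K * x.ht := by
  set c := Real.cosh (dist center (g center) / 2) with hc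
  have hc0 : 0 < c := Real.cosh_pos _
  refine ⟨(2 * c) ^ 2, by positivity, fun x => ?_⟩
  set u := Real.cosh (dist center (g x) / 2) with hu
  set v := Real.cosh (dist center x / 2) with hv
  have hu0 : 0 < u := Real.cosh_pos _
  have hv0 : 0 < v := Real.cosh_pos _
  have h1 : v ≤ 2 * c * u := by
    have h2 : dist center x ≤ dist center (g center) + dist center (g x) := by
      rw [← g.dist_eq center x, dist_comm center (g center)]
      exact dist_triangle _ _ _
    have h3 : v ≤ Real.cosh (dist center (g center) / 2 + dist center (g x) / 2) := by
      rw [hv, Real.cosh_le_cosh, abs_of_nonneg (by positivity), abs_of_nonneg (by positivity)]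
      linarith
    rw [Real.cosh_add] at h3
    have h4 := (Real.sinh_lt_cosh (dist center (g center) / 2)).le
    have h5 := (Real.sinh_lt_cosh (dist center (g x) / 2)).le
    have h6 : 0 ≤ Real.sinh (dist center (g x) / 2) := Real.sinh_nonneg_iff.2 (by positivity)
    have h7 := mul_le_mul h4 h5 h6 hc0.le
    nlinarith
  rw [ht_eq, ht_eq, ← hu, ← hv, inv_le_iff_one_le_mul₀ (by positivity)]
  rw [mul_assoc, mul_comm, mul_assoc, ← div_eq_inv_mul, one_le_div (by positivity)]
  nlinarith [mul_self_le_mul_self hv0.le h1]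

lemma exists_dist_le (g : HypSpace n ≃ᵢ HypSpace n) :
    ∃ K : ℝ, 0 < K ∧ ∀ x y, dist (g x).pt (g y).pt ≤ K * dist x.pt y.pt := by
  obtain ⟨K, hK, h⟩ := exists_ht_le g
  refine ⟨K, hK, fun x y => ?_⟩
  have hx := x.ht_pos
  have hy := y.ht_pos
  have hgx := (g x).ht_pos
  have hgy := (g y).ht_pos
  have h1 : dist (g x).pt (g y).pt / √((g x).ht * (g y).ht) =
      dist x.pt y.pt / √(x.ht * y.ht) := by
    rw [← sinh_half_hdist, ← sinh_half_hdist]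
    have h2 : hdist (g x) (g y) = hdist x y := g.dist_eq x y
    rw [h2]
  have h3 : √((g x).ht * (g y).ht) ≤ K * √(x.ht * y.ht) := by
    rw [Real.sqrt_le_left (by positivity), mul_pow, Real.sq_sqrt (by positivity)]
    nlinarith [mul_le_mul (h x) (h y) hgy.le (by positivity)]
  rw [div_eq_div_iff (by positivity) (by positivity)] at h1
  have h4 : 0 < √(x.ht * y.ht) := by positivity
  refine le_of_mul_le_mul_right ?_ h4
  rw [h1]
  nlinarith [mul_le_mul_of_nonneg_left h3 (dist_nonneg (x := x.pt) (y := y.pt))]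

end HypSpace

/-- The boundary at infinity of hyperbolic `n`-space: the unit sphere bounding the ball. -/
@[ext]
structure HypBoundary (n : ℕ) where
  /-- The underlying point of the unit sphere. -/
  pt : EuclideanSpace ℝ (Fin n)
  norm_eq : ‖pt‖ = 1

namespace HypBoundary

variable {n : ℕ}

/-- The boundary carries the spherical metric: the distance of two points is the angle (in
radians) between the rays from the centre of the ball to them. -/
instance : MetricSpace (HypBoundary n) where
  dist ξ η := InnerProductGeometry.angle ξ.pt η.pt
  dist_self ξ := InnerProductGeometry.angle_self (norm_ne_zero_iff.1 (by simp [ξ.norm_eq]))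
  dist_comm ξ η := InnerProductGeometry.angle_comm _ _
  dist_triangle ξ η ζ := InnerProductGeometry.angle_le_angle_add_angle _ _ _
  eq_of_dist_eq_zero {ξ η} h := by
    refine HypBoundary.ext ?_
    obtain ⟨-, r, hr, h1⟩ := InnerProductGeometry.angle_eq_zero_iff.1 h
    have h2 := η.norm_eq
    rw [h1, norm_smul, ξ.norm_eq, mul_one, Real.norm_eq_abs, abs_of_pos hr] at h2
    rw [h1, h2, one_smul]

lemma dist_def (ξ η : HypBoundary n) : dist ξ η = InnerProductGeometry.angle ξ.pt η.pt := rfl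

/-- The filter of points of hyperbolic space that approach the boundary point `ξ`, in the
topology of the closed unit ball. -/
def approach (ξ : HypBoundary n) : Filter (HypSpace n) := comap HypSpace.pt (𝓝 ξ.pt)

instance (ξ : HypBoundary n) : (approach ξ).NeBot := by
  rw [approach, comap_neBot_iff_frequently]
  have h : Tendsto (fun t : ℝ => t • ξ.pt) (𝓝[<] 1) (𝓝 ξ.pt) := by
    have h1 : Tendsto (fun t : ℝ => t • ξ.pt) (𝓝 1) (𝓝 ((1 : ℝ) • ξ.pt)) :=
      (continuous_id.smul continuous_const).tendsto 1
    rw [one_smul] at h1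
    exact h1.mono_left nhdsWithin_le_nhds
  refine h.frequently (Eventually.frequently ?_)
  have h2 : Set.Ioo (0 : ℝ) 1 ∈ 𝓝[<] (1 : ℝ) := Ioo_mem_nhdsLT zero_lt_one
  filter_upwards [h2] with t ht
  refine ⟨⟨t • ξ.pt, ?_⟩, rfl⟩
  rw [norm_smul, ξ.norm_eq, mul_one, Real.norm_eq_abs, abs_of_pos ht.1]
  exact ht.2

/-- Every isometry of hyperbolic space extends to the boundary. -/
lemma exists_tendsto (g : HypSpace n ≃ᵢ HypSpace n) (ξ : HypBoundary n) :
    ∃ η : HypBoundary n, Tendsto g (approach ξ) (approach η) := by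
  have hpt : Tendsto HypSpace.pt (approach ξ) (𝓝 ξ.pt) := tendsto_comap
  obtain ⟨K, hK, hd⟩ := HypSpace.exists_dist_le g
  obtain ⟨L, hL, hh⟩ := HypSpace.exists_ht_le g
  have hc : Cauchy (map (fun x => (g x).pt) (approach ξ)) := by
    rw [cauchy_map_iff]
    refine ⟨inferInstance, ?_⟩
    rw [tendsto_uniformity_iff_dist_tendsto_zero]
    have h1 : Tendsto (fun p : HypSpace n × HypSpace n => K * dist p.1.pt p.2.pt)
        (approach ξ ×ˢ approach ξ) (𝓝 (K * dist ξ.pt ξ.pt)) :=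
      ((hpt.comp tendsto_fst).dist (hpt.comp tendsto_snd)).const_mul K
    rw [dist_self, mul_zero] at h1
    exact squeeze_zero (fun _ => dist_nonneg) (fun p => hd p.1 p.2) h1
  obtain ⟨η, hη⟩ := CompleteSpace.complete hc
  have hη' : Tendsto (fun x => (g x).pt) (approach ξ) (𝓝 η) := hη
  have h0 : Tendsto (fun x : HypSpace n => x.ht) (approach ξ) (𝓝 0) := by
    have h1 : Tendsto (fun x : HypSpace n => 1 - ‖x.pt‖ ^ 2) (approach ξ)
        (𝓝 (1 - ‖ξ.pt‖ ^ 2)) := (hpt.norm.pow 2).const_sub 1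
    rw [ξ.norm_eq, one_pow, sub_self] at h1
    exact h1
  have h1 : Tendsto (fun x => (g x).ht) (approach ξ) (𝓝 0) := by
    have h2 := h0.const_mul L
    rw [mul_zero] at h2
    exact squeeze_zero (fun x => (g x).ht_pos.le) hh h2
  have h2 : Tendsto (fun x => (g x).ht) (approach ξ) (𝓝 (1 - ‖η‖ ^ 2)) :=
    (hη'.norm.pow 2).const_sub 1
  have h3 := tendsto_nhds_unique h1 h2
  have h4 : ‖η‖ = 1 := by nlinarith [norm_nonneg η]
  exact ⟨⟨η, h4⟩, tendsto_comap_iff.2 hη'⟩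

lemma eq_of_tendsto {f : HypSpace n → HypSpace n} {ξ η η' : HypBoundary n}
    (h : Tendsto f (approach ξ) (approach η)) (h' : Tendsto f (approach ξ) (approach η')) :
    η = η' :=
  HypBoundary.ext (tendsto_nhds_unique (tendsto_comap_iff.1 h) (tendsto_comap_iff.1 h'))

/-- The action of the isometry group on the boundary: `g • ξ` is the limit of `g x` as the point
`x` of hyperbolic space tends to `ξ`. -/
instance : SMul (HypSpace n ≃ᵢ HypSpace n) (HypBoundary n) :=
  ⟨fun g ξ => (exists_tendsto g ξ).choose⟩

lemma tendsto_smul (g : HypSpace n ≃ᵢ HypSpace n) (ξ : HypBoundary n) :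
    Tendsto g (approach ξ) (approach (g • ξ)) :=
  (exists_tendsto g ξ).choose_spec

instance : MulAction (HypSpace n ≃ᵢ HypSpace n) (HypBoundary n) where
  one_smul ξ := eq_of_tendsto (tendsto_smul 1 ξ) tendsto_id
  mul_smul g h ξ :=
    eq_of_tendsto (tendsto_smul (g * h) ξ) ((tendsto_smul g (h • ξ)).comp (tendsto_smul h ξ))

end HypBoundary

/-- A group of isometries is parabolic if there is a unique boundary point that is fixed by all
of its elements. -/
def IsParabolic {n : ℕ} (P : Subgroup (HypSpace n ≃ᵢ HypSpace n)) : Prop :=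
  ∃! w : HypBoundary n, ∀ p ∈ P, p • w = w

/-- The critical exponent `inf {s ∈ ℝ : ∑_{g ∈ P} exp (-s d(o, g o)) < ∞}` of the Poincaré series
of `P` with reference point `o`, as an extended real number (`+∞` if the series never
converges). -/
def criticalExponent {n : ℕ} (o : HypSpace n) (P : Subgroup (HypSpace n ≃ᵢ HypSpace n)) : EReal :=
  sInf ((fun s : ℝ => (s : EReal)) '' {s : ℝ | Summable fun g : P => Real.exp (-s * dist o (g.1 o))})

/-! ### Box dimension -/

section BoxDim

variable {M : Type*} [MetricSpace M]

/-- The smallest number of sets of diameter at most `δ` needed to cover `F`. -/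
def coverNumber (δ : ℝ) (F : Set M) : ℕ∞ :=
  ⨅ (C : Set (Set M)) (_ : (∀ U ∈ C, Metric.ediam U ≤ ENNReal.ofReal δ) ∧ F ⊆ ⋃₀ C), C.encard

/-- The quotient `log N_δ(F) / (-log δ)`. -/
def boxRatio (F : Set M) (δ : ℝ) : EReal :=
  ENNReal.log (coverNumber δ F : ENNReal) / ((-Real.log δ : ℝ) : EReal)

/-- The lower box dimension. -/
def lowerBoxDim (F : Set M) : EReal := liminf (boxRatio F) (𝓝[>] 0)

/-- The upper box dimension. -/
def upperBoxDim (F : Set M) : EReal := limsup (boxRatio F) (𝓝[>] 0)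

/-- The box dimension of `F` exists, and it is `d`. -/
def HasBoxDim (F : Set M) (d : EReal) : Prop := lowerBoxDim F = d ∧ upperBoxDim F = d

end BoxDim

end

/-! Let w be the common fixed point. An element of P that scales the horospheres at w has, possibly
after inversion, a contracting action on the rest of the boundary, hence a second fixed point a.
Some h in P moves a, and conjugating h by the powers of the contraction gives infinitely many
elements that move a point of hyperbolic space a bounded amount, against discreteness
(`horoScale_eq_one`). So in stereographic coordinates from w the group acts properly by Euclidean
isometries (`exists_affine_action`).

Such a group grows like a lattice, by a Bieberbach argument. Elements whose linear parts are close
to the identity commute, because their iterated commutators shrink until properness makes one of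
them trivial (`commute_of_rotDev_le`). The commutative subgroup they generate moves the origin like
a lattice of some rank k, and every element is within bounded displacement of that subgroup. Hence
about R^k elements have displacement at most R (`exists_growth_of_hom`); k is positive because P is
infinite.

Write y_p for the stereographic coordinate of pξ. The upper half-space distance formula makes
exp(d(o,po)/2) comparable to 1 + |y_p| (`exists_exp_dist_bounds`), so the Poincaré series behaves
like the sum of (1 + |y_p|)^(-2s) and the critical exponent is k/2
(`criticalExponent_eq_of_growth`).

Stereographic projection shrinks lengths near y by a factor of order (1 + |y|)^2. Lower bound:
distinct orbit points with |y| of order at most r^(-1/2) are r-separated, and there are about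
r^(-k/2) of them (`exists_le_coverNumber`). Upper bound: for q slightly above k/2, give each p the
mass (1 + |y_p|)^(-2q). The total is finite, while each point of a separated net at scale r owns a
disjoint share of order at least r^q; what lies beyond |y| of order 1/r fits in one cap at w
(`exists_coverNumber_le`). -/

/-! ### Discrete groups of Euclidean isometries -/

section Euclid

open scoped commutatorElement

variable {E : Type*} [NormedAddCommGroup E] [InnerProductSpace ℝ E]

/-- The linear part of an affine isometry, as a continuous linear map. -/
noncomputable def rotPart (g : E ≃ᵃⁱ[ℝ] E) : E →L[ℝ] E :=
  (g.linearIsometryEquiv.toContinuousLinearEquiv : E →L[ℝ] E)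

lemma rotPart_apply (g : E ≃ᵃⁱ[ℝ] E) (x : E) : rotPart g x = g.linearIsometryEquiv x := rfl

lemma apply_eq_rotPart_add (g : E ≃ᵃⁱ[ℝ] E) (x : E) : g x = rotPart g x + g 0 := by
  have := g.map_vadd 0 x
  simpa [rotPart_apply] using this

lemma rotPart_apply_eq_sub (g : E ≃ᵃⁱ[ℝ] E) (x : E) : rotPart g x = g x - g 0 := by
  rw [apply_eq_rotPart_add g x, add_sub_cancel_right]

lemma mul_apply_apply (g h : E ≃ᵃⁱ[ℝ] E) (x : E) : (g * h) x = g (h x) := rfl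

lemma norm_rotPart_apply (g : E ≃ᵃⁱ[ℝ] E) (x : E) : ‖rotPart g x‖ = ‖x‖ := by
  rw [rotPart_apply, LinearIsometryEquiv.norm_map]

lemma rotPart_mul (g h : E ≃ᵃⁱ[ℝ] E) : rotPart (g * h) = rotPart g * rotPart h := by
  ext x
  change _ = rotPart g (rotPart h x)
  rw [rotPart_apply_eq_sub, rotPart_apply_eq_sub h, map_sub,
    rotPart_apply_eq_sub, rotPart_apply_eq_sub]
  simp

lemma rotPart_one : rotPart (1 : E ≃ᵃⁱ[ℝ] E) = 1 := by
  ext x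
  rw [rotPart_apply_eq_sub]
  simp

lemma rotPart_mul_inv (g : E ≃ᵃⁱ[ℝ] E) : rotPart g * rotPart g⁻¹ = 1 := by
  rw [← rotPart_mul, mul_inv_cancel, rotPart_one]

lemma rotPart_inv_mul (g : E ≃ᵃⁱ[ℝ] E) : rotPart g⁻¹ * rotPart g = 1 := by
  rw [← rotPart_mul, inv_mul_cancel, rotPart_one]

lemma rotPart_apply_inv_apply (g : E ≃ᵃⁱ[ℝ] E) (x : E) : rotPart g (rotPart g⁻¹ x) = x := by
  rw [← mul_apply_eq_comp, rotPart_mul_inv, one_apply_eq_self]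

lemma inner_rotPart (g : E ≃ᵃⁱ[ℝ] E) (x y : E) :
    inner ℝ (rotPart g x) (rotPart g y) = inner ℝ x y :=
  g.linearIsometryEquiv.inner_map_map x y

lemma inner_rotPart_left (g : E ≃ᵃⁱ[ℝ] E) (x y : E) :
    inner ℝ (rotPart g x) y = inner ℝ x (rotPart g⁻¹ y) := by
  rw [← inner_rotPart g x, rotPart_apply_inv_apply]

lemma norm_rotPart_mul (g : E ≃ᵃⁱ[ℝ] E) (T : E →L[ℝ] E) : ‖rotPart g * T‖ = ‖T‖ := by
  have key : ∀ (g : E ≃ᵃⁱ[ℝ] E) (T : E →L[ℝ] E), ‖rotPart g * T‖ ≤ ‖T‖ := fun g T =>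
    ContinuousLinearMap.opNorm_le_bound _ (norm_nonneg _) fun x => by
      rw [mul_apply_eq_comp, norm_rotPart_apply]
      exact T.le_opNorm x
  refine le_antisymm (key g T) ?_
  have := key g⁻¹ (rotPart g * T)
  rwa [← mul_assoc, rotPart_inv_mul, one_mul] at this

lemma norm_mul_rotPart (g : E ≃ᵃⁱ[ℝ] E) (T : E →L[ℝ] E) : ‖T * rotPart g‖ = ‖T‖ := by
  have key : ∀ (g : E ≃ᵃⁱ[ℝ] E) (T : E →L[ℝ] E), ‖T * rotPart g‖ ≤ ‖T‖ := fun g T =>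
    ContinuousLinearMap.opNorm_le_bound _ (norm_nonneg _) fun x => by
      rw [mul_apply_eq_comp, ← norm_rotPart_apply g x]
      exact T.le_opNorm _
  refine le_antisymm (key g T) ?_
  have := key g⁻¹ (T * rotPart g)
  rwa [mul_assoc, rotPart_mul_inv, mul_one] at this

/-- The distance of the linear part of an affine isometry from the identity. -/
noncomputable def rotDev (g : E ≃ᵃⁱ[ℝ] E) : ℝ := ‖rotPart g - 1‖

lemma rotDev_nonneg (g : E ≃ᵃⁱ[ℝ] E) : 0 ≤ rotDev g := norm_nonneg _

lemma rotDev_mul_le (g h : E ≃ᵃⁱ[ℝ] E) : rotDev (g * h) ≤ rotDev g + rotDev h := by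
  have e : rotPart (g * h) - 1 = rotPart g * (rotPart h - 1) + (rotPart g - 1) := by
    rw [rotPart_mul]; noncomm_ring
  rw [rotDev, e, add_comm (rotDev g)]
  exact (norm_add_le _ _).trans_eq (by rw [norm_rotPart_mul]; rfl)

lemma rotDev_inv (g : E ≃ᵃⁱ[ℝ] E) : rotDev g⁻¹ = rotDev g := by
  have e : rotPart g⁻¹ - 1 = rotPart g⁻¹ * (1 - rotPart g) := by
    rw [mul_sub, rotPart_inv_mul, mul_one]
  rw [rotDev, e, norm_rotPart_mul, norm_sub_rev, rotDev]

lemma rotDev_conj (g h : E ≃ᵃⁱ[ℝ] E) : rotDev (g * h * g⁻¹) = rotDev h := by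
  have e : rotPart (g * h * g⁻¹) - 1 = rotPart g * (rotPart h - 1) * rotPart g⁻¹ := by
    rw [mul_sub, sub_mul, mul_one, rotPart_mul_inv, rotPart_mul, rotPart_mul]
  rw [rotDev, e, norm_mul_rotPart, norm_rotPart_mul, rotDev]

/-- Subtracting the identity from both factors does not change AB - BA, so it is quadratically small
in the deviations. This makes iterated commutators contract. -/
lemma norm_comm_sub_le (g h : E ≃ᵃⁱ[ℝ] E) :
    ‖rotPart g * rotPart h - rotPart h * rotPart g‖ ≤ 2 * rotDev g * rotDev h := by
  have e : rotPart g * rotPart h - rotPart h * rotPart g =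
      (rotPart g - 1) * (rotPart h - 1) - (rotPart h - 1) * (rotPart g - 1) := by
    noncomm_ring
  rw [e]
  refine (norm_sub_le _ _).trans ?_
  have h1 := norm_mul_le (rotPart g - 1) (rotPart h - 1)
  have h2 := norm_mul_le (rotPart h - 1) (rotPart g - 1)
  simp only [rotDev]
  nlinarith

lemma rotDev_commutator_le (g h : E ≃ᵃⁱ[ℝ] E) : rotDev ⁅g, h⁆ ≤ 2 * rotDev g * rotDev h := by
  refine le_trans (le_of_eq ?_) (norm_comm_sub_le g h)
  have e : rotPart g * rotPart h - rotPart h * rotPart g =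
      (rotPart ⁅g, h⁆ - 1) * rotPart (h * g) := by
    rw [sub_mul, ← rotPart_mul, commutatorElement_def, one_mul, ← rotPart_mul, ← rotPart_mul]
    congr 2
    group
  rw [e, norm_mul_rotPart, rotDev]

/-- With x = (hg)⁻¹ 0 the left side is (gh)x = (gh)x - (hg)x; the first summand on the right
vanishes when the linear parts commute. -/
lemma commutator_apply_zero (g h : E ≃ᵃⁱ[ℝ] E) :
    ⁅g, h⁆ 0 = (rotPart g * rotPart h - rotPart h * rotPart g) ((h * g)⁻¹ 0) +
      ((rotPart g - 1) (h 0) - (rotPart h - 1) (g 0)) := by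
  have e : ∀ x, ⁅g, h⁆ ((h * g) x) = (g * h) x := fun x => by
    rw [← mul_apply_apply]
    congr 1
    rw [commutatorElement_def]
    group
  set x := (h * g)⁻¹ 0 with hx
  have hx0 : (h * g) x = 0 := by
    rw [hx, ← mul_apply_apply, mul_inv_cancel]
    rfl
  have h1 := e x
  rw [hx0] at h1
  have h2 : ⁅g, h⁆ 0 = (g * h) x - (h * g) x := by rw [hx0, sub_zero, h1]
  rw [h2, mul_apply_apply, mul_apply_apply, apply_eq_rotPart_add g (h x), apply_eq_rotPart_add h x,
    apply_eq_rotPart_add h (g x), apply_eq_rotPart_add g x]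
  simp only [map_add, sub_apply, mul_apply_eq_comp, one_apply_eq_self]
  abel

lemma norm_inv_apply_zero (g : E ≃ᵃⁱ[ℝ] E) : ‖g⁻¹ 0‖ = ‖g 0‖ := by
  have h : g (g⁻¹ 0) = 0 := by
    rw [← mul_apply_apply, mul_inv_cancel]
    rfl
  rw [apply_eq_rotPart_add] at h
  rw [← norm_rotPart_apply g, eq_neg_of_add_eq_zero_left h, norm_neg]

lemma norm_mul_apply_zero_le (g h : E ≃ᵃⁱ[ℝ] E) : ‖(g * h) 0‖ ≤ ‖g 0‖ + ‖h 0‖ := by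
  rw [mul_apply_apply, apply_eq_rotPart_add, add_comm ‖g 0‖]
  exact (norm_add_le _ _).trans_eq (by rw [norm_rotPart_apply])

lemma norm_commutator_apply_zero_le (g h : E ≃ᵃⁱ[ℝ] E) :
    ‖⁅g, h⁆ 0‖ ≤ 2 * rotDev g * rotDev h * (‖g 0‖ + ‖h 0‖) + rotDev g * ‖h 0‖ +
      rotDev h * ‖g 0‖ := by
  rw [commutator_apply_zero]
  have h1 : ‖(rotPart g * rotPart h - rotPart h * rotPart g) ((h * g)⁻¹ 0)‖ ≤
      2 * rotDev g * rotDev h * (‖g 0‖ + ‖h 0‖) := by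
    refine (ContinuousLinearMap.le_opNorm _ _).trans ?_
    rw [norm_inv_apply_zero]
    have := norm_mul_apply_zero_le h g
    rw [add_comm] at this
    gcongr
    · have := rotDev_nonneg g; have := rotDev_nonneg h; positivity
    · exact norm_comm_sub_le g h
  have h2 : ‖(rotPart g - 1) (h 0)‖ ≤ rotDev g * ‖h 0‖ := ContinuousLinearMap.le_opNorm _ _
  have h3 : ‖(rotPart h - 1) (g 0)‖ ≤ rotDev h * ‖g 0‖ := ContinuousLinearMap.le_opNorm _ _
  have h4 := norm_add_le ((rotPart g * rotPart h - rotPart h * rotPart g) ((h * g)⁻¹ 0))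
    ((rotPart g - 1) (h 0) - (rotPart h - 1) (g 0))
  have h5 := norm_sub_le ((rotPart g - 1) (h 0)) ((rotPart h - 1) (g 0))
  linarith

lemma eq_one_of_rotPart_eq_one {g : E ≃ᵃⁱ[ℝ] E} (h : rotPart g = 1) (h0 : g 0 = 0) : g = 1 := by
  ext x
  rw [apply_eq_rotPart_add, h, h0]
  simp

/-- Squaring 1 + D turns D into 2D + D², and ‖D‖ ≤ 1/2 makes the new deviation at least 3/2 of the
old one. Boundedness along all powers then forces T = 1: there are no small subgroups. -/
lemma norm_sub_one_mul_pow_le (T : E →L[ℝ] E) (h : ∀ n : ℕ, ‖T ^ n - 1‖ ≤ 1 / 2) (k : ℕ) :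
    (3 / 2) ^ k * ‖T - 1‖ ≤ ‖T ^ (2 ^ k) - 1‖ := by
  induction k with
  | zero => simp
  | succ k ih =>
    set D := T ^ (2 ^ k) - 1 with hD
    have e : T ^ (2 ^ (k + 1)) - 1 = (2 : ℝ) • D + D * D := by
      rw [pow_succ, pow_mul, hD, two_smul]; noncomm_ring
    have h1 : ‖(2 : ℝ) • D‖ ≤ ‖(2 : ℝ) • D + D * D‖ + ‖D * D‖ := by
      have := norm_sub_le ((2 : ℝ) • D + D * D) (D * D)
      rwa [add_sub_cancel_right] at this
    rw [norm_smul, Real.norm_two] at h1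
    have h2 := norm_mul_le D D
    have h3 := h (2 ^ k)
    rw [e, pow_succ]
    nlinarith [norm_nonneg D]

lemma eq_one_of_forall_norm_pow_sub_one_le (T : E →L[ℝ] E) (h : ∀ n : ℕ, ‖T ^ n - 1‖ ≤ 1 / 2) :
    T = 1 := by
  by_contra hT
  have hpos : 0 < ‖T - 1‖ := norm_pos_iff.2 (sub_ne_zero.2 hT)
  obtain ⟨k, hk⟩ := pow_unbounded_of_one_lt (1 / ‖T - 1‖) (by norm_num : (1 : ℝ) < 3 / 2)
  rw [div_lt_iff₀ hpos] at hk
  have h1 := norm_sub_one_mul_pow_le T h k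
  have h2 := h (2 ^ k)
  linarith

/-- If the linear part of `g` commutes with that of the commutator `⁅g, h⁆` and `h` is close to
being a translation, then the linear part of the commutator is trivial. -/
lemma rotPart_commutator_eq_one {g h : E ≃ᵃⁱ[ℝ] E}
    (hc : rotPart g * rotPart ⁅g, h⁆ = rotPart ⁅g, h⁆ * rotPart g) (hh : rotDev h ≤ 1 / 4) :
    rotPart ⁅g, h⁆ = 1 := by
  -- Each conjugation by g contributes one factor of the commutator. So the n-th power of its linear
  -- part is that of a conjugate of h times h⁻¹, within 2 · 1/4 of the identity for every n.
  have key : ∀ n : ℕ, rotPart (g ^ n * h * (g ^ n)⁻¹) = rotPart ⁅g, h⁆ ^ n * rotPart h := by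
    intro n
    induction n with
    | zero => simp
    | succ n ih =>
      have e : g ^ (n + 1) * h * (g ^ (n + 1))⁻¹ = g * (g ^ n * h * (g ^ n)⁻¹) * g⁻¹ := by
        rw [pow_succ']; group
      have hc' : Commute (rotPart g) (rotPart ⁅g, h⁆ ^ n) := Commute.pow_right hc n
      rw [e, rotPart_mul, rotPart_mul, ih, ← mul_assoc, hc'.eq, mul_assoc, mul_assoc, ← rotPart_mul,
        ← rotPart_mul, pow_succ, mul_assoc, ← rotPart_mul]
      congr 2
      rw [commutatorElement_def]
      group
  refine eq_one_of_forall_norm_pow_sub_one_le _ fun n => ?_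
  have e : rotPart ⁅g, h⁆ ^ n = rotPart (g ^ n * h * (g ^ n)⁻¹ * h⁻¹) := by
    rw [rotPart_mul, key, mul_assoc, rotPart_mul_inv, mul_one]
  rw [e]
  have h1 := rotDev_mul_le (g ^ n * h * (g ^ n)⁻¹) h⁻¹
  rw [rotDev_conj, rotDev_inv, rotDev] at h1
  linarith

/-- An orthogonal map A has no Jordan block at eigenvalue 1: if u = Av - v is fixed, then A maps v -
u to v and v to v + u. These three vectors have equal norm, which forces u = 0. -/
lemma rotPart_apply_eq_self_of_sq {g : E ≃ᵃⁱ[ℝ] E} {v : E}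
    (h : (rotPart g - 1) ((rotPart g - 1) v) = 0) : (rotPart g - 1) v = 0 := by
  set u := (rotPart g - 1) v with hu
  have h1 : rotPart g u = u := by
    simpa [sub_eq_zero] using h
  have h2 : rotPart g v = v + u := by rw [hu]; simp
  have h3 : rotPart g (v - u) = v := by rw [map_sub, h1, h2, add_sub_cancel_right]
  have e2 := norm_rotPart_apply g v
  have e3 := norm_rotPart_apply g (v - u)
  rw [h2] at e2
  rw [h3] at e3
  have f2 := norm_add_sq_real v u
  have f3 := norm_sub_sq_real v u
  rw [e2] at f2
  rw [← e3] at f3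
  have : ‖u‖ ^ 2 = 0 := by linarith
  simpa using this

lemma rotPart_apply_eq_self_of_pow {g : E ≃ᵃⁱ[ℝ] E} {v : E} (k : ℕ)
    (h : ((rotPart g - 1) ^ (k + 1)) v = 0) : (rotPart g - 1) v = 0 := by
  induction k with
  | zero => simpa using h
  | succ k ih =>
    apply ih
    rw [pow_succ', mul_apply_eq_comp] at h ⊢
    rw [pow_succ', mul_apply_eq_comp] at h
    exact rotPart_apply_eq_self_of_sq h

/-- Iterated commutators with `g`. -/
noncomputable def iterCommutator (g h : E ≃ᵃⁱ[ℝ] E) (k : ℕ) : E ≃ᵃⁱ[ℝ] E := (fun x => ⁅g, x⁆)^[k] h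

lemma iterCommutator_succ (g h : E ≃ᵃⁱ[ℝ] E) (k : ℕ) :
    iterCommutator g h (k + 1) = ⁅g, iterCommutator g h k⁆ :=
  Function.iterate_succ_apply' _ _ _

lemma iterCommutator_mem {Γ : Subgroup (E ≃ᵃⁱ[ℝ] E)} {g h : E ≃ᵃⁱ[ℝ] E} (hg : g ∈ Γ) (hh : h ∈ Γ)
    (k : ℕ) : iterCommutator g h k ∈ Γ := by
  induction k with
  | zero => exact hh
  | succ k ih =>
    rw [iterCommutator_succ, commutatorElement_def]
    exact Γ.mul_mem (Γ.mul_mem (Γ.mul_mem hg ih) (Γ.inv_mem hg)) (Γ.inv_mem ih)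

lemma rotDev_iterCommutator_le {g h : E ≃ᵃⁱ[ℝ] E} (hg : rotDev g ≤ 1 / 8) (hh : rotDev h ≤ 1 / 8)
    (k : ℕ) : rotDev (iterCommutator g h k) ≤ 1 / 8 * (1 / 4) ^ k := by
  induction k with
  | zero => simpa [iterCommutator] using hh
  | succ k ih =>
    rw [iterCommutator_succ]
    have h1 := rotDev_commutator_le g (iterCommutator g h k)
    have h2 := rotDev_nonneg (iterCommutator g h k)
    rw [pow_succ]
    nlinarith

/-- One step keeps at most 5/32 of the previous displacement and adds at most 5/32 · (1/2)^k ‖g 0‖,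
the decay coming from the rotational deviation. The factor 5 absorbs the added term with room to
spare. -/
lemma norm_iterCommutator_le {g h : E ≃ᵃⁱ[ℝ] E} (hg : rotDev g ≤ 1 / 8) (hh : rotDev h ≤ 1 / 8)
    (k : ℕ) : ‖iterCommutator g h k 0‖ ≤ (5 * ‖g 0‖ + ‖h 0‖) * (1 / 2) ^ k := by
  induction k with
  | zero => simp [iterCommutator]
  | succ k ih =>
    rw [iterCommutator_succ]
    set c := iterCommutator g h k
    have h1 := norm_commutator_apply_zero_le g c
    have h2 : rotDev c ≤ 1 / 8 * (1 / 4) ^ k := rotDev_iterCommutator_le hg hh k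
    have h3 : (1 / 4 : ℝ) ^ k ≤ (1 / 2) ^ k := by gcongr; norm_num
    have h5 : (1 / 4 : ℝ) ^ k ≤ 1 := pow_le_one₀ (by norm_num) (by norm_num)
    have h4 : 2 * rotDev g * rotDev c ≤ 1 / 4 * rotDev c := by nlinarith [rotDev_nonneg c]
    have h6 := norm_nonneg (g 0)
    have h7 := norm_nonneg (c 0)
    have h8 : 2 * rotDev g * rotDev c * (‖g 0‖ + ‖c 0‖) ≤
        (1 / 32 * (1 / 2) ^ k) * ‖g 0‖ + 1 / 32 * ‖c 0‖ := by
      have h81 : 2 * rotDev g * rotDev c ≤ 1 / 32 * (1 / 2) ^ k := by linarith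
      have h82 : 2 * rotDev g * rotDev c ≤ 1 / 32 := by linarith
      rw [mul_add]
      exact add_le_add (mul_le_mul_of_nonneg_right h81 h6) (mul_le_mul_of_nonneg_right h82 h7)
    have h9 : rotDev g * ‖c 0‖ ≤ 1 / 8 * ‖c 0‖ := by gcongr
    have h10 : rotDev c * ‖g 0‖ ≤ 1 / 8 * (1 / 2) ^ k * ‖g 0‖ := by gcongr; linarith
    rw [pow_succ]
    have h11 : 0 ≤ ‖h 0‖ * (1 / 2) ^ k := by positivity
    have h12 : 0 ≤ ‖g 0‖ * (1 / 2) ^ k := by positivity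
    nlinarith

/-- A group of affine isometries is proper if every ball contains only finitely many points of the
orbit of the origin, counted with multiplicity. -/
def IsProperGroup (Γ : Subgroup (E ≃ᵃⁱ[ℝ] E)) : Prop :=
  ∀ R : ℝ, {g : E ≃ᵃⁱ[ℝ] E | g ∈ Γ ∧ ‖g 0‖ ≤ R}.Finite

/-- All iterates lie in a finite set by properness, so one value recurs infinitely often. Its
rotational deviation and its displacement of the origin are below every positive bound, so it is the
identity. -/
lemma exists_iterCommutator_eq_one {Γ : Subgroup (E ≃ᵃⁱ[ℝ] E)} (hΓ : IsProperGroup Γ)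
    {g h : E ≃ᵃⁱ[ℝ] E} (hgΓ : g ∈ Γ) (hhΓ : h ∈ Γ) (hg : rotDev g ≤ 1 / 8)
    (hh : rotDev h ≤ 1 / 8) : ∃ k, iterCommutator g h (k + 1) = 1 := by
  set C := 5 * ‖g 0‖ + ‖h 0‖ with hC
  have hC0 : 0 ≤ C := by positivity
  set F := {x : E ≃ᵃⁱ[ℝ] E | x ∈ Γ ∧ ‖x 0‖ ≤ C}
  have hF : F.Finite := hΓ C
  have hmem : ∀ k, iterCommutator g h (k + 1) ∈ F := fun k =>
    ⟨iterCommutator_mem hgΓ hhΓ _, (norm_iterCommutator_le hg hh _).trans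
      (mul_le_of_le_one_right hC0 (pow_le_one₀ (by norm_num) (by norm_num)))⟩
  obtain ⟨x, hx⟩ : ∃ x, ∃ᶠ k in atTop, iterCommutator g h (k + 1) = x := by
    have := hF.to_subtype
    obtain ⟨y, hy⟩ := Finite.exists_infinite_fiber (fun k : ℕ => (⟨_, hmem k⟩ : F))
    refine ⟨y, Nat.frequently_atTop_iff_infinite.2 ?_⟩
    convert Set.infinite_coe_iff.1 hy using 1
    ext k
    simp [Subtype.ext_iff]
  have t1 : Tendsto (fun k : ℕ => 1 / 8 * (1 / 4 : ℝ) ^ (k + 1)) atTop (𝓝 (1 / 8 * 0)) :=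
    ((tendsto_pow_atTop_nhds_zero_of_lt_one (by norm_num) (by norm_num)).comp
      (tendsto_add_atTop_nat 1)).const_mul _
  have t2 : Tendsto (fun k : ℕ => C * (1 / 2 : ℝ) ^ (k + 1)) atTop (𝓝 (C * 0)) :=
    ((tendsto_pow_atTop_nhds_zero_of_lt_one (by norm_num) (by norm_num)).comp
      (tendsto_add_atTop_nat 1)).const_mul _
  rw [mul_zero] at t1 t2
  have e1 : rotDev x ≤ 0 := by
    refine le_of_forall_pos_lt_add fun ε hε => ?_
    obtain ⟨k, hk, hk'⟩ := (hx.and_eventually (t1.eventually (gt_mem_nhds hε))).exists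
    rw [zero_add, ← hk]
    exact (rotDev_iterCommutator_le hg hh _).trans_lt hk'
  have e2 : ‖x 0‖ ≤ 0 := by
    refine le_of_forall_pos_lt_add fun ε hε => ?_
    obtain ⟨k, hk, hk'⟩ := (hx.and_eventually (t2.eventually (gt_mem_nhds hε))).exists
    rw [zero_add, ← hk]
    exact (norm_iterCommutator_le hg hh _).trans_lt hk'
  obtain ⟨k, hk⟩ := hx.exists
  exact ⟨k, hk.trans (eq_one_of_rotPart_eq_one (sub_eq_zero.1 (norm_le_zero_iff.1 e1))
    (norm_le_zero_iff.1 e2))⟩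

/-- Descent from the trivial iterate: if an iterate has trivial linear part, then g commutes
linearly with the preceding one, which `rotPart_commutator_eq_one` then makes trivial too. -/
lemma rotPart_commutator_eq_one_of_mem {Γ : Subgroup (E ≃ᵃⁱ[ℝ] E)} (hΓ : IsProperGroup Γ)
    {g h : E ≃ᵃⁱ[ℝ] E} (hgΓ : g ∈ Γ) (hhΓ : h ∈ Γ) (hg : rotDev g ≤ 1 / 8)
    (hh : rotDev h ≤ 1 / 8) : rotPart ⁅g, h⁆ = 1 := by
  obtain ⟨k, hk⟩ := exists_iterCommutator_eq_one hΓ hgΓ hhΓ hg hh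
  have key : ∀ k, rotPart (iterCommutator g h (k + 1)) = 1 → rotPart ⁅g, h⁆ = 1 := by
    intro k
    induction k with
    | zero => exact id
    | succ k ih =>
      intro h1
      apply ih
      rw [iterCommutator_succ]
      refine rotPart_commutator_eq_one ?_ ((rotDev_iterCommutator_le hg hh _).trans ?_)
      · rw [← iterCommutator_succ, ← rotPart_mul, ← rotPart_mul]
        rw [iterCommutator_succ, commutatorElement_def] at h1
        have h2 := congrArg (fun T => T * rotPart (iterCommutator g h (k + 1) * g)) h1
        simp only [one_mul, ← rotPart_mul] at h2
        rw [← h2]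
        congr 1
        group
      · have : (1 / 4 : ℝ) ^ k ≤ 1 := pow_le_one₀ (by norm_num) (by norm_num)
        linarith
  exact key k (by rw [hk, rotPart_one])

/-- The commutator of g, with linear part A, and the translation by v is the translation by (A -
1)v. -/
lemma iterCommutator_apply_zero {g h : E ≃ᵃⁱ[ℝ] E} (h1 : rotPart ⁅g, h⁆ = 1) (k : ℕ) :
    rotPart (iterCommutator g h (k + 1)) = 1 ∧
      iterCommutator g h (k + 1) 0 = ((rotPart g - 1) ^ k) (⁅g, h⁆ 0) := by
  induction k with
  | zero => exact ⟨h1, by simp [iterCommutator]⟩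
  | succ k ih =>
    set c := iterCommutator g h (k + 1)
    rw [iterCommutator_succ]
    constructor
    · have : rotDev ⁅g, c⁆ ≤ 0 := by
        refine (rotDev_commutator_le g c).trans_eq ?_
        rw [rotDev, rotDev, ih.1, sub_self, norm_zero, mul_zero]
      exact sub_eq_zero.1 (norm_le_zero_iff.1 this)
    · rw [commutator_apply_zero, ih.1, ih.2, pow_succ']
      simp

lemma commutator_fixed {Γ : Subgroup (E ≃ᵃⁱ[ℝ] E)} (hΓ : IsProperGroup Γ)
    {g h : E ≃ᵃⁱ[ℝ] E} (hgΓ : g ∈ Γ) (hhΓ : h ∈ Γ) (hg : rotDev g ≤ 1 / 8)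
    (hh : rotDev h ≤ 1 / 8) : (rotPart g - 1) (⁅g, h⁆ 0) = 0 := by
  obtain ⟨k, hk⟩ := exists_iterCommutator_eq_one hΓ hgΓ hhΓ hg hh
  refine rotPart_apply_eq_self_of_pow k ?_
  have := (iterCommutator_apply_zero (rotPart_commutator_eq_one_of_mem hΓ hgΓ hhΓ hg hh) k).2
  rw [hk] at this
  rw [pow_succ', mul_apply_eq_comp, ← this]
  simp

lemma inner_rotPart_sub_one {g : E ≃ᵃⁱ[ℝ] E} {v : E} (h : (rotPart g - 1) v = 0) (u : E) :
    inner ℝ v ((rotPart g - 1) u) = 0 := by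
  have h1 : rotPart g v = v := by simpa [sub_eq_zero] using h
  have h2 := inner_rotPart g v u
  rw [h1] at h2
  rw [sub_apply, one_apply_eq_self, inner_sub_right, h2, sub_self]

/-- Elements of a proper group whose linear parts are close to the identity commute. -/
lemma commute_of_rotDev_le {Γ : Subgroup (E ≃ᵃⁱ[ℝ] E)} (hΓ : IsProperGroup Γ)
    {g h : E ≃ᵃⁱ[ℝ] E} (hgΓ : g ∈ Γ) (hhΓ : h ∈ Γ) (hg : rotDev g ≤ 1 / 8)
    (hh : rotDev h ≤ 1 / 8) : g * h = h * g := by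
  have h1 := rotPart_commutator_eq_one_of_mem hΓ hgΓ hhΓ hg hh
  have h2 := commutator_fixed hΓ hgΓ hhΓ hg hh
  have h3 : (rotPart h - 1) (⁅g, h⁆ 0) = 0 := by
    have h4 := commutator_fixed hΓ hhΓ hgΓ hh hg
    rw [← commutatorElement_inv] at h4
    have h5 := apply_eq_rotPart_add ⁅g, h⁆ (⁅g, h⁆⁻¹ 0)
    rw [← mul_apply_apply, mul_inv_cancel, h1]
      at h5
    simp only [AffineIsometryEquiv.coe_one, id_eq, one_apply_eq_self] at h5
    rw [eq_neg_of_add_eq_zero_left h5.symm, map_neg, neg_eq_zero] at h4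
    exact h4
  rw [← commutatorElement_eq_one_iff_mul_comm]
  refine eq_one_of_rotPart_eq_one h1 ?_
  have h6 : rotPart g * rotPart h - rotPart h * rotPart g = 0 := by
    have h7 := congrArg (fun T => T * rotPart (h * g)) h1
    simp only [one_mul, ← rotPart_mul] at h7
    rw [sub_eq_zero, ← rotPart_mul, ← rotPart_mul, ← h7, commutatorElement_def]
    congr 1
    group
  have h8 := commutator_apply_zero g h
  rw [h6, zero_apply, zero_add] at h8
  -- The translation vector of the commutator is fixed by both linear parts A and B, yet it is a
  -- difference of values of A - 1 and B - 1, which are orthogonal to such vectors.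
  have h9 : inner ℝ (⁅g, h⁆ 0) (⁅g, h⁆ 0) = 0 := by
    nth_rewrite 2 [h8]
    rw [inner_sub_right, inner_rotPart_sub_one h2, inner_rotPart_sub_one h3, sub_zero]
  exact inner_self_eq_zero.1 h9

end Euclid

/-! ### Polynomial growth of proper groups of Euclidean isometries. -/

section Growth

lemma discreteTopology_of_finite_inter_closedBall {E : Type*} [NormedAddCommGroup E]
    (L : Submodule ℤ E)
    (h : {v : E | v ∈ L ∧ ‖v‖ ≤ 1}.Finite) : DiscreteTopology L := by
  apply discreteTopology_of_isOpen_singleton_zero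
  have h1 : IsOpen (Metric.ball (0 : E) 1 ∩ ({v : E | v ∈ L ∧ ‖v‖ ≤ 1} \ {0})ᶜ) :=
    Metric.isOpen_ball.inter (h.subset Set.sdiff_subset).isClosed.isOpen_compl
  convert h1.preimage (continuous_subtype_val (p := fun v => v ∈ L)) using 1
  ext ⟨v, hv⟩
  simp only [Set.mem_singleton_iff, Set.mem_preimage, Set.mem_inter_iff, Metric.mem_ball,
    dist_zero_right, Set.mem_compl_iff, Set.mem_sdiff, Set.mem_ofPred_eq, not_and, not_not]
  constructor
  · intro h2
    obtain rfl : v = 0 := congrArg Subtype.val h2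
    simp
  · rintro ⟨h2, h3⟩
    exact Subtype.ext (h3 ⟨hv, h2.le⟩)

variable {E : Type*} [NormedAddCommGroup E] [InnerProductSpace ℝ E]

/-- The common fixed vectors of the linear parts of a group of affine isometries. -/
def fixedVectors (Δ : Subgroup (E ≃ᵃⁱ[ℝ] E)) : Submodule ℝ E where
  carrier := {v | ∀ g ∈ Δ, rotPart g v = v}
  zero_mem' := fun g _ => map_zero _
  add_mem' := fun hv hw g hg => by rw [map_add, hv g hg, hw g hg]
  smul_mem' := fun c v hv g hg => by rw [map_smul, hv g hg]

/-- The directions in which a group of affine isometries moves the origin by a bounded amount. -/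
def boundedDirections (Δ : Subgroup (E ≃ᵃⁱ[ℝ] E)) : Submodule ℝ E where
  carrier := {u | ∃ C : ℝ, ∀ g ∈ Δ, |inner ℝ u (g 0)| ≤ C}
  zero_mem' := ⟨0, fun g _ => by simp⟩
  add_mem' := by
    rintro u v ⟨C, hC⟩ ⟨D, hD⟩
    refine ⟨C + D, fun g hg => ?_⟩
    rw [inner_add_left]
    exact (abs_add_le _ _).trans (add_le_add (hC g hg) (hD g hg))
  smul_mem' := by
    rintro c u ⟨C, hC⟩
    refine ⟨|c| * C, fun g hg => ?_⟩
    rw [real_inner_smul_left, abs_mul]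
    exact mul_le_mul_of_nonneg_left (hC g hg) (abs_nonneg c)

/-- Commutation of a with g gives (1 - A)(g 0) = (1 - G)(a 0) for the linear parts A of a and G of
g, of norm at most 2‖a 0‖ whatever g is. So the range of the adjoint of 1 - A consists of bounded
directions, and a vector orthogonal to all these ranges is fixed by every A. -/
lemma orthogonal_fixedVectors_le [FiniteDimensional ℝ E] {Δ : Subgroup (E ≃ᵃⁱ[ℝ] E)}
    (hΔ : ∀ g ∈ Δ, ∀ h ∈ Δ, g * h = h * g) :
    (fixedVectors Δ)ᗮ ≤ boundedDirections Δ := by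
  have h1 : ∀ a ∈ Δ, ∀ w : E, w - rotPart a⁻¹ w ∈ boundedDirections Δ := by
    intro a ha w
    refine ⟨‖w‖ * (‖a 0‖ + ‖a 0‖), fun g hg => ?_⟩
    have e : g 0 - rotPart a (g 0) = a 0 - rotPart g (a 0) := by
      have h := congrArg (fun f : E ≃ᵃⁱ[ℝ] E => f 0) (hΔ a ha g hg)
      simp only [mul_apply_apply] at h
      rw [apply_eq_rotPart_add a (g 0), apply_eq_rotPart_add g (a 0)] at h
      rw [sub_eq_sub_iff_add_eq_add, add_comm, ← h, add_comm]
    have e2 : inner ℝ (w - rotPart a⁻¹ w) (g 0) = inner ℝ w (a 0 - rotPart g (a 0)) := by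
      rw [← e, inner_sub_left, inner_rotPart_left, inv_inv, inner_sub_right]
    rw [e2]
    refine (abs_real_inner_le_norm _ _).trans (mul_le_mul_of_nonneg_left ?_ (norm_nonneg _))
    exact (norm_sub_le _ _).trans_eq (by rw [norm_rotPart_apply])
  have h2 : (boundedDirections Δ)ᗮ ≤ fixedVectors Δ := by
    intro v hv a ha
    have h3 : ∀ w, inner ℝ w (v - rotPart a v) = 0 := by
      intro w
      have h4 := (Submodule.mem_orthogonal _ _).1 hv _ (h1 a ha w)
      rwa [inner_sub_left, inner_rotPart_left, inv_inv, ← inner_sub_right] at h4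
    have h5 := inner_self_eq_zero.1 (h3 (v - rotPart a v))
    exact (sub_eq_zero.1 h5).symm
  calc (fixedVectors Δ)ᗮ ≤ (boundedDirections Δ)ᗮᗮ := Submodule.orthogonal_le h2
    _ = boundedDirections Δ := Submodule.orthogonal_orthogonal _

lemma exists_norm_sub_starProjection_le [FiniteDimensional ℝ E] {Δ : Subgroup (E ≃ᵃⁱ[ℝ] E)}
    (hΔ : ∀ g ∈ Δ, ∀ h ∈ Δ, g * h = h * g) :
    ∃ C : ℝ, ∀ g ∈ Δ, ‖g 0 - (fixedVectors Δ).starProjection (g 0)‖ ≤ C := by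
  set b := stdOrthonormalBasis ℝ (fixedVectors Δ)ᗮ
  have h1 : ∀ i, ∃ C : ℝ, ∀ g ∈ Δ, |inner ℝ (b i : E) (g 0)| ≤ C := fun i =>
    orthogonal_fixedVectors_le hΔ (b i).2
  choose C hC using h1
  refine ⟨∑ i, C i, fun g hg => ?_⟩
  set x : (fixedVectors Δ)ᗮ := ⟨g 0 - (fixedVectors Δ).starProjection (g 0),
    Submodule.sub_starProjection_mem_orthogonal _⟩ with hx
  have h2 : ‖x‖ ≤ ∑ i, C i := by
    rw [← b.sum_repr' x]
    refine (norm_sum_le _ _).trans (Finset.sum_le_sum fun i _ => ?_)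
    rw [norm_smul, b.orthonormal.1 i, mul_one, Real.norm_eq_abs]
    refine le_trans (le_of_eq ?_) (hC i g hg)
    congr 1
    rw [hx, Submodule.coe_inner]
    change inner ℝ (b i : E) (g 0 - _) = _
    rw [inner_sub_right, Submodule.inner_left_of_mem_orthogonal
      (Submodule.starProjection_apply_mem _ _) (b i).2, sub_zero]
  exact h2

lemma starProjection_rotPart [FiniteDimensional ℝ E] {Δ : Subgroup (E ≃ᵃⁱ[ℝ] E)}
    {g : E ≃ᵃⁱ[ℝ] E} (hg : g ∈ Δ) (u : E) :
    (fixedVectors Δ).starProjection (rotPart g u) = (fixedVectors Δ).starProjection u := by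
  rw [← sub_eq_zero, ← map_sub, Submodule.starProjection_apply_eq_zero_iff,
    Submodule.mem_orthogonal]
  intro v hv
  have := inner_rotPart_sub_one (g := g) (v := v) (by simp [hv g hg]) u
  simpa using this

/-- Linear parts are invisible after projection to their common fixed vectors, so the projected
orbit map is a homomorphism and its image is an additive group. -/
lemma starProjection_mul_apply_zero [FiniteDimensional ℝ E] {Δ : Subgroup (E ≃ᵃⁱ[ℝ] E)}
    {g : E ≃ᵃⁱ[ℝ] E} (hg : g ∈ Δ) (h : E ≃ᵃⁱ[ℝ] E) :
    (fixedVectors Δ).starProjection ((g * h) 0) =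
      (fixedVectors Δ).starProjection (g 0) + (fixedVectors Δ).starProjection (h 0) := by
  rw [mul_apply_apply, apply_eq_rotPart_add, map_add, starProjection_rotPart hg, add_comm]

/-- The projections to the common fixed vectors of the orbit of the origin. -/
def translationLattice [FiniteDimensional ℝ E] (Δ : Subgroup (E ≃ᵃⁱ[ℝ] E)) : Submodule ℤ E :=
  AddSubgroup.toIntSubmodule
    { carrier := {v | ∃ g ∈ Δ, (fixedVectors Δ).starProjection (g 0) = v}
      zero_mem' := ⟨1, Δ.one_mem, by simp⟩
      add_mem' := by
        rintro _ _ ⟨g, hg, rfl⟩ ⟨h, hh, rfl⟩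
        exact ⟨g * h, Δ.mul_mem hg hh, starProjection_mul_apply_zero hg h⟩
      neg_mem' := by
        rintro _ ⟨g, hg, rfl⟩
        refine ⟨g⁻¹, Δ.inv_mem hg, ?_⟩
        rw [eq_neg_iff_add_eq_zero, ← starProjection_mul_apply_zero (Δ.inv_mem hg), inv_mul_cancel]
        simp }

/-- A commutative proper group of affine isometries moves the origin like a lattice. -/
lemma exists_lattice_of_comm [FiniteDimensional ℝ E] {Δ : Subgroup (E ≃ᵃⁱ[ℝ] E)}
    (hΔ : ∀ g ∈ Δ, ∀ h ∈ Δ, g * h = h * g) (hp : IsProperGroup Δ) :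
    ∃ (L : Submodule ℤ E) (_ : DiscreteTopology L) (C : ℝ), 0 ≤ C ∧
      (∀ g ∈ Δ, ∃ v ∈ L, ‖g 0 - v‖ ≤ C) ∧
      ∃ f : L → E ≃ᵃⁱ[ℝ] E, Function.Injective f ∧ ∀ v, f v ∈ Δ ∧ ‖f v 0 - v‖ ≤ C := by
  obtain ⟨C, hC⟩ := exists_norm_sub_starProjection_le hΔ
  have hC0 : 0 ≤ C := (norm_nonneg _).trans (hC 1 Δ.one_mem)
  have hf : ∀ v : translationLattice Δ, ∃ g ∈ Δ, (fixedVectors Δ).starProjection (g 0) = v :=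
    fun v => v.2
  choose f hfΔ hf using hf
  refine ⟨translationLattice Δ, ?_, C, hC0, fun g hg => ⟨_, ⟨g, hg, rfl⟩, hC g hg⟩, f, ?_,
    fun v => ⟨hfΔ v, ?_⟩⟩
  · apply discreteTopology_of_finite_inter_closedBall
    refine ((hp (C + 1)).image fun g => (fixedVectors Δ).starProjection (g 0)).subset ?_
    rintro _ ⟨⟨g, hg, rfl⟩, h1⟩
    refine ⟨g, ⟨hg, ?_⟩, rfl⟩
    have h2 := norm_sub_norm_le (g 0) ((fixedVectors Δ).starProjection (g 0))
    have h3 := hC g hg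
    linarith
  · intro v w h
    apply Subtype.ext
    rw [← hf v, ← hf w, h]
  · rw [← hf v]
    exact hC _ (hfΔ v)

lemma exists_finset_lattice (L : Submodule ℤ E) [FiniteDimensional ℝ E] [DiscreteTopology L] :
    ∃ c : ℝ, 0 < c ∧ ∀ R : ℝ, 0 ≤ R → ∃ T : Finset L,
      c * R ^ Module.finrank ℤ L ≤ T.card ∧ ∀ v ∈ T, ‖v‖ ≤ R := by
  set b := Module.finBasis ℤ L
  -- The summand 1 keeps B positive in rank zero. Basis coefficients between 0 and ⌊R/B⌋ give
  -- vectors of norm at most R.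
  set B : ℝ := 1 + ∑ i, ‖b i‖ with hB
  have hB0 : 0 < B := by positivity
  refine ⟨(1 / B) ^ Module.finrank ℤ L, by positivity, fun R hR => ?_⟩
  set m := ⌊R / B⌋₊ with hm
  have hmR : m * B ≤ R := by
    rw [← le_div_iff₀ hB0]
    exact Nat.floor_le (by positivity)
  refine ⟨(Fintype.piFinset fun _ => Finset.Icc (0 : ℤ) m).map
    b.equivFun.symm.toEquiv.toEmbedding, ?_, ?_⟩
  · rw [Finset.card_map, Fintype.card_piFinset, Finset.prod_const, Finset.card_univ,
      Fintype.card_fin, Int.card_Icc, ← mul_pow, one_div_mul_eq_div, sub_zero]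
    have h1 : ((m : ℤ) + 1).toNat = m + 1 := by omega
    rw [h1, Nat.cast_pow]
    gcongr
    push_cast
    exact (Nat.lt_floor_add_one _).le
  · intro v hv
    obtain ⟨z, hz, rfl⟩ := Finset.mem_map.1 hv
    rw [Fintype.mem_piFinset] at hz
    have e : b.equivFun.symm.toEquiv.toEmbedding z = ∑ i, z i • b i :=
      b.equivFun_symm_apply z
    rw [e]
    have hzi : ∀ i, ‖z i • b i‖ ≤ m * ‖b i‖ := by
      intro i
      have h1 := Finset.mem_Icc.1 (hz i)
      refine (norm_zsmul_le _ _).trans (mul_le_mul_of_nonneg_right ?_ (norm_nonneg _))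
      rw [Int.norm_eq_abs, abs_of_nonneg (by exact_mod_cast h1.1)]
      exact_mod_cast h1.2
    calc ‖∑ i, z i • b i‖ ≤ ∑ i, ‖z i • b i‖ := norm_sum_le _ _
      _ ≤ ∑ i, m * ‖b i‖ := Finset.sum_le_sum fun i _ => hzi i
      _ = m * ∑ i, ‖b i‖ := by rw [Finset.mul_sum]
      _ ≤ m * B := by gcongr; linarith
      _ ≤ R := hmR

lemma summable_lattice (L : Submodule ℤ E) [FiniteDimensional ℝ E] [DiscreteTopology L] {s : ℝ}
    (hs : Module.finrank ℤ L < s) : Summable fun v : L => (1 + ‖v‖) ^ (-s) := by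
  classical
  have h1 := ZLattice.summable_norm_rpow L (-s) (by linarith)
  -- The power of ‖v‖ is a majorant only for nonzero v; this term takes care of v = 0.
  have h2 : Summable fun v : L => if v = 0 then (1 : ℝ) else 0 :=
    summable_of_ne_finset_zero (s := {0}) fun v hv => if_neg (by simpa using hv)
  refine (h1.add h2).of_nonneg_of_le (fun v => by positivity) fun v => ?_
  split_ifs with hv
  · have : 0 ≤ ‖v‖ ^ (-s) := by positivity
    simpa [hv] using this
  · rw [add_zero]
    have hv' : 0 < ‖v‖ := norm_pos_iff.2 hv
    have hs0 : (0 : ℝ) ≤ Module.finrank ℤ L := by positivity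
    exact Real.rpow_le_rpow_of_nonpos hv' (by linarith) (by linarith)

lemma summable_comp_of_card_fiber_le {α β : Type*} {f : α → β} {g : β → ℝ} (hg0 : ∀ b, 0 ≤ g b)
    (hg : Summable g) {M : ℕ} (hM : ∀ b, ∀ s : Finset α, (∀ a ∈ s, f a = b) → s.card ≤ M) :
    Summable fun a => g (f a) := by
  classical
  refine summable_of_sum_le (c := M * ∑' b, g b) (fun a => hg0 _) fun s => ?_
  rw [Finset.sum_comp]
  calc ∑ b ∈ s.image f, (s.filter fun a => f a = b).card • g b
      ≤ ∑ b ∈ s.image f, M * g b := by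
        refine Finset.sum_le_sum fun b _ => ?_
        rw [nsmul_eq_mul]
        have : (s.filter fun a => f a = b).card ≤ M :=
          hM b _ fun a ha => (Finset.mem_filter.1 ha).2
        have h2 := hg0 b
        gcongr
    _ = M * ∑ b ∈ s.image f, g b := by rw [Finset.mul_sum]
    _ ≤ M * ∑' b, g b := by
        gcongr
        exact hg.sum_le_tsum _ fun b _ => hg0 b

/-- The subgroup generated by the elements with linear part close to the identity. -/
noncomputable def smallSubgroup (Γ : Subgroup (E ≃ᵃⁱ[ℝ] E)) : Subgroup (E ≃ᵃⁱ[ℝ] E) :=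
  Subgroup.closure {g | g ∈ Γ ∧ rotDev g ≤ 1 / 8}

lemma smallSubgroup_le (Γ : Subgroup (E ≃ᵃⁱ[ℝ] E)) : smallSubgroup Γ ≤ Γ :=
  (Subgroup.closure_le _).2 fun _ h => h.1

lemma smallSubgroup_comm {Γ : Subgroup (E ≃ᵃⁱ[ℝ] E)} (hΓ : IsProperGroup Γ) :
    ∀ g ∈ smallSubgroup Γ, ∀ h ∈ smallSubgroup Γ, g * h = h * g := by
  set S := {g | g ∈ Γ ∧ rotDev g ≤ 1 / 8}
  have h1 : smallSubgroup Γ ≤ Subgroup.centralizer S :=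
    (Subgroup.closure_le _).2 fun g hg => Subgroup.mem_centralizer_iff.2 fun h hh =>
      commute_of_rotDev_le hΓ hh.1 hg.1 hh.2 hg.2
  have h2 : smallSubgroup Γ ≤ Subgroup.centralizer (smallSubgroup Γ : Set (E ≃ᵃⁱ[ℝ] E)) :=
    (Subgroup.closure_le _).2 fun g hg => Subgroup.mem_centralizer_iff.2 fun h hh =>
      (Subgroup.mem_centralizer_iff.1 (h1 hh) g hg).symm
  exact fun g hg h hh => (Subgroup.mem_centralizer_iff.1 (h2 hg) h hh).symm

/-- The linear parts lie in a compact ball, so finitely many elements of Γ approximate all of them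
to within 1/8. Dividing by the approximating element lands in the small subgroup and changes the
displacement by a bounded amount. -/
lemma exists_mem_smallSubgroup [FiniteDimensional ℝ E] (Γ : Subgroup (E ≃ᵃⁱ[ℝ] E)) :
    ∃ C : ℝ, ∀ g ∈ Γ, ∃ h ∈ smallSubgroup Γ, ‖g 0 - h 0‖ ≤ C := by
  have h1 : TotallyBounded (rotPart '' (Γ : Set (E ≃ᵃⁱ[ℝ] E))) := by
    refine TotallyBounded.subset ?_
      (isCompact_closedBall (0 : E →L[ℝ] E) 1).totallyBounded
    rintro _ ⟨g, -, rfl⟩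
    rw [mem_closedBall_zero_iff]
    exact ContinuousLinearMap.opNorm_le_bound _ zero_le_one fun x => by
      rw [norm_rotPart_apply, one_mul]
  obtain ⟨t, ht, htf, hcov⟩ := Metric.finite_approx_of_totallyBounded h1 (1 / 8) (by norm_num)
  have ht' : ∀ T : E →L[ℝ] E, T ∈ t → ∃ g ∈ Γ, rotPart g = T := fun T hT => ht hT
  choose! q hqΓ hq using ht'
  obtain ⟨C, hC⟩ := (htf.image fun T => ‖q T 0‖).bddAbove
  refine ⟨C, fun g hg => ?_⟩
  obtain ⟨T, hT, hgT⟩ := Set.mem_iUnion₂.1 (hcov ⟨g, hg, rfl⟩)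
  refine ⟨g * (q T)⁻¹, Subgroup.subset_closure ⟨Γ.mul_mem hg (Γ.inv_mem (hqΓ T hT)), ?_⟩, ?_⟩
  · have e : rotPart (g * (q T)⁻¹) - 1 = (rotPart g - rotPart (q T)) * rotPart (q T)⁻¹ := by
      rw [sub_mul, rotPart_mul_inv, rotPart_mul]
    rw [rotDev, e, norm_mul_rotPart, hq T hT, ← dist_eq_norm]
    exact (Metric.mem_ball.1 hgT).le
  · have e : g 0 = (g * (q T)⁻¹) (q T 0) := by
      rw [← mul_apply_apply, inv_mul_cancel_right]
    nth_rewrite 1 [e]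
    rw [← dist_eq_norm, AffineIsometryEquiv.dist_map, dist_zero_right]
    exact hC ⟨T, hT, rfl⟩

lemma norm_inv_mul_apply_zero (g h : E ≃ᵃⁱ[ℝ] E) : ‖(g⁻¹ * h) 0‖ = ‖g 0 - h 0‖ := by
  have e : g ((g⁻¹ * h) 0) = h 0 := by rw [← mul_apply_apply, mul_inv_cancel_left]
  rw [← e, ← dist_eq_norm, AffineIsometryEquiv.dist_map, dist_zero_left]

/-- A proper group of affine isometries of a Euclidean space has polynomial growth of an integral
degree. -/
theorem exists_growth [FiniteDimensional ℝ E] {Γ : Subgroup (E ≃ᵃⁱ[ℝ] E)} (hΓ : IsProperGroup Γ) :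
    ∃ k : ℕ, (∀ s : ℝ, k < s → Summable fun g : Γ => (1 + ‖g.1 0‖) ^ (-s)) ∧
      (∃ c : ℝ, 0 < c ∧ ∀ R : ℝ, 0 ≤ R → ∃ T : Finset Γ, c * R ^ k ≤ T.card ∧
        ∀ g ∈ T, ‖g.1 0‖ ≤ R) ∧
      (k = 0 → Finite Γ) := by
  classical
  obtain ⟨L, hL, C, hC0, hap, f, hfi, hf⟩ := exists_lattice_of_comm (smallSubgroup_comm hΓ)
    (fun R => (hΓ R).subset fun g hg => ⟨smallSubgroup_le Γ hg.1, hg.2⟩)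
  obtain ⟨D, hD⟩ := exists_mem_smallSubgroup Γ
  have hD0 : 0 ≤ D := by
    obtain ⟨h, -, h1⟩ := hD 1 Γ.one_mem
    exact (norm_nonneg _).trans h1
  have hΦ : ∀ g : Γ, ∃ v : L, ‖g.1 0 - v‖ ≤ D + C := by
    intro g
    obtain ⟨h, hh, h1⟩ := hD g.1 g.2
    obtain ⟨v, hv, h2⟩ := hap h hh
    refine ⟨⟨v, hv⟩, ?_⟩
    calc ‖g.1 0 - v‖ = ‖(g.1 0 - h 0) + (h 0 - v)‖ := by abel_nf
      _ ≤ _ := (norm_add_le _ _).trans (add_le_add h1 h2)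
  choose Φ hΦ using hΦ
  set K := D + C with hK
  have hK0 : 0 ≤ K := by positivity
  have hfin : ∀ R : ℝ, {g : Γ | ‖g.1 0‖ ≤ R}.Finite := fun R =>
    ((hΓ R).preimage Subtype.val_injective.injOn).subset fun g hg => ⟨g.2, hg⟩
  refine ⟨Module.finrank ℤ L, fun s hs => ?_, ?_, fun h0 => ?_⟩
  · have hs0 : (0 : ℝ) ≤ Module.finrank ℤ L := by positivity
    have h1 : Summable fun g : Γ => (1 + ‖Φ g‖) ^ (-s) := by
      -- Two elements g, h assigned to the same lattice vector satisfy ‖(g⁻¹h) 0‖ ≤ 2K, so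
      -- properness bounds the fibres uniformly.
      refine summable_comp_of_card_fiber_le (f := Φ) (g := fun v : L => (1 + ‖v‖) ^ (-s))
        (fun v => by positivity) (summable_lattice L hs) (M := (hfin (2 * K)).toFinset.card) ?_
      intro v t ht
      rcases t.eq_empty_or_nonempty with rfl | ⟨g, hg⟩
      · simp
      rw [← Finset.card_image_of_injective t (mul_right_injective g⁻¹)]
      refine Finset.card_le_card fun h hh => ?_
      obtain ⟨h, hht, rfl⟩ := Finset.mem_image.1 hh
      rw [Set.Finite.mem_toFinset, Set.mem_ofPred_eq]
      have e := norm_inv_mul_apply_zero g.1 h.1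
      have h2 := hΦ g
      have h3 := hΦ h
      rw [ht g hg] at h2
      rw [ht h hht, norm_sub_rev] at h3
      have h4 := norm_add_le (g.1 0 - (v : E)) ((v : E) - h.1 0)
      rw [sub_add_sub_cancel] at h4
      change ‖(g.1⁻¹ * h.1) 0‖ ≤ 2 * K
      linarith
    refine (h1.mul_left ((1 + K) ^ s)).of_nonneg_of_le (fun g => by positivity) fun g => ?_
    have h2 : (1 + ‖Φ g‖) / (1 + K) ≤ 1 + ‖g.1 0‖ := by
      rw [div_le_iff₀ (by positivity)]
      have h3 := norm_sub_norm_le (Φ g : E) (g.1 0)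
      rw [norm_sub_rev] at h3
      have h4 := hΦ g
      have h5 : ‖(Φ g : E)‖ = ‖Φ g‖ := rfl
      nlinarith [norm_nonneg (g.1 0)]
    calc (1 + ‖g.1 0‖) ^ (-s) ≤ ((1 + ‖Φ g‖) / (1 + K)) ^ (-s) :=
          Real.rpow_le_rpow_of_nonpos (by positivity) h2 (by linarith)
      _ = (1 + K) ^ s * (1 + ‖Φ g‖) ^ (-s) := by
          rw [Real.div_rpow (by positivity) (by positivity), Real.rpow_neg (x := 1 + K)
            (by positivity), div_inv_eq_mul, mul_comm]
  · obtain ⟨c, hc, h1⟩ := exists_finset_lattice L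
    set k := Module.finrank ℤ L
    -- For R ≤ 2C the identity alone is enough; for larger R the lattice count is used at radius R -
    -- C ≥ R/2.
    set c' := min (c * (1 / 2) ^ k) (1 / (1 + 2 * C) ^ k) with hc'
    refine ⟨c', by positivity, fun R hR => ?_⟩
    rcases le_total R (2 * C) with hRC | hRC
    · refine ⟨{1}, ?_, ?_⟩
      · rw [Finset.card_singleton, Nat.cast_one]
        calc c' * R ^ k ≤ 1 / (1 + 2 * C) ^ k * (1 + 2 * C) ^ k := by
              gcongr
              · exact min_le_right _ _
              · linarith
          _ = 1 := by field_simp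
      · intro g hg
        rw [Finset.mem_singleton.1 hg]
        simpa using hR
    · obtain ⟨T, hT, hTR⟩ := h1 (R - C) (by linarith)
      refine ⟨T.image fun v => ⟨f v, smallSubgroup_le Γ (hf v).1⟩, ?_, ?_⟩
      · rw [Finset.card_image_of_injective _ fun v w h => hfi (congrArg Subtype.val h)]
        refine le_trans ?_ hT
        calc c' * R ^ k ≤ c * (1 / 2) ^ k * R ^ k := by
              gcongr
              exact min_le_left _ _
          _ = c * (R / 2) ^ k := by rw [mul_assoc, ← mul_pow]; ring
          _ ≤ c * (R - C) ^ k := by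
              gcongr
              linarith
      · intro g hg
        obtain ⟨v, hv, rfl⟩ := Finset.mem_image.1 hg
        have h3 := norm_sub_norm_le (f v 0) (v : E)
        have h4 := (hf v).2
        have h5 := hTR v hv
        have h6 : ‖(v : E)‖ = ‖v‖ := rfl
        change ‖f v 0‖ ≤ R
        linarith
  · have h1 : Subsingleton L := (Module.finrank_eq_zero_iff_of_free ℤ L).1 h0
    have h2 : (Set.univ : Set Γ) ⊆ {g : Γ | ‖g.1 0‖ ≤ K} := by
      intro g _
      have h3 := hΦ g
      rw [Subsingleton.elim (Φ g) 0] at h3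
      simpa using h3
    exact Set.finite_univ_iff.1 ((hfin K).subset h2)

/-- Growth of a group acting properly by affine isometries. -/
theorem exists_growth_of_hom [FiniteDimensional ℝ E] {G : Type*} [Group G] (θ : G →* (E ≃ᵃⁱ[ℝ] E))
    (hθ : ∀ R : ℝ, {g : G | ‖θ g 0‖ ≤ R}.Finite) (x : E) :
    ∃ k : ℕ, (∀ s : ℝ, k < s → Summable fun g : G => (1 + ‖θ g x‖) ^ (-s)) ∧
      (∃ c : ℝ, 0 < c ∧ ∀ R : ℝ, 0 ≤ R → ∃ T : Finset G, c * R ^ k ≤ T.card ∧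
        ∀ g ∈ T, ‖θ g x - x‖ ≤ R) ∧
      (k = 0 → Finite G) := by
  classical
  have hΓ : IsProperGroup θ.range := by
    intro R
    refine ((hθ R).image θ).subset ?_
    rintro _ ⟨⟨g, rfl⟩, hg⟩
    exact ⟨g, hg, rfl⟩
  have hx : ∀ g, ‖θ g x - θ g 0‖ = ‖x‖ := fun g => by
    rw [← dist_eq_norm, AffineIsometryEquiv.dist_map, dist_zero_right]
  obtain ⟨k, h1, ⟨c, hc, h2⟩, h3⟩ := exists_growth hΓ
  -- Fibres are cosets of the kernel, which lies in the finite set of elements fixing the origin.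
  have hker : ∀ γ : θ.range, ∀ s : Finset G, (∀ g ∈ s, θ.rangeRestrict g = γ) →
      s.card ≤ (hθ 0).toFinset.card := by
    intro γ s hs
    rcases s.eq_empty_or_nonempty with rfl | ⟨g, hg⟩
    · simp
    rw [← Finset.card_image_of_injective s (mul_right_injective g⁻¹)]
    refine Finset.card_le_card fun h hh => ?_
    obtain ⟨h, hhs, rfl⟩ := Finset.mem_image.1 hh
    have e : θ g = θ h := congrArg Subtype.val ((hs g hg).trans (hs h hhs).symm)
    simp [e]
  refine ⟨k, fun s hs => ?_, ?_, fun h0 => ?_⟩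
  · have h4 := summable_comp_of_card_fiber_le (f := θ.rangeRestrict)
      (g := fun γ => (1 + ‖γ.1 0‖) ^ (-s)) (fun γ => by positivity) (h1 s hs) hker
    refine (h4.mul_left ((1 + ‖x‖) ^ s)).of_nonneg_of_le (fun g => by positivity) fun g => ?_
    have h2 : (1 + ‖θ g 0‖) / (1 + ‖x‖) ≤ 1 + ‖θ g x‖ := by
      rw [div_le_iff₀ (by positivity)]
      have h3 := norm_sub_norm_le (θ g 0) (θ g x)
      rw [norm_sub_rev, hx] at h3
      nlinarith [norm_nonneg (θ g x), norm_nonneg x]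
    have hs0 : (0 : ℝ) ≤ k := by positivity
    calc (1 + ‖θ g x‖) ^ (-s) ≤ ((1 + ‖θ g 0‖) / (1 + ‖x‖)) ^ (-s) :=
          Real.rpow_le_rpow_of_nonpos (by positivity) h2 (by linarith)
      _ = (1 + ‖x‖) ^ s * (1 + ‖θ g 0‖) ^ (-s) := by
          rw [Real.div_rpow (by positivity) (by positivity), Real.rpow_neg (x := 1 + ‖x‖)
            (by positivity), div_inv_eq_mul, mul_comm]
  · set c' := min (c * (1 / 2) ^ k) (1 / (1 + 4 * ‖x‖) ^ k) with hc'
    refine ⟨c', by positivity, fun R hR => ?_⟩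
    rcases le_total R (4 * ‖x‖) with hRC | hRC
    · refine ⟨{1}, ?_, ?_⟩
      · rw [Finset.card_singleton, Nat.cast_one]
        calc c' * R ^ k ≤ 1 / (1 + 4 * ‖x‖) ^ k * (1 + 4 * ‖x‖) ^ k := by
              gcongr
              · exact min_le_right _ _
              · linarith
          _ = 1 := by field_simp
      · intro g hg
        rw [Finset.mem_singleton.1 hg]
        simpa using hR
    · obtain ⟨T, hT, hTR⟩ := h2 (R - 2 * ‖x‖) (by linarith [norm_nonneg x])
      have hsur : ∀ γ : θ.range, ∃ g, θ.rangeRestrict g = γ := θ.rangeRestrict_surjective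
      choose f hf using hsur
      have hfi : Function.Injective f := fun a b h => by rw [← hf a, ← hf b, h]
      refine ⟨T.image f, ?_, ?_⟩
      · rw [Finset.card_image_of_injective _ hfi]
        refine le_trans ?_ hT
        calc c' * R ^ k ≤ c * (1 / 2) ^ k * R ^ k := by
              gcongr
              exact min_le_left _ _
          _ = c * (R / 2) ^ k := by rw [mul_assoc, ← mul_pow]; ring
          _ ≤ c * (R - 2 * ‖x‖) ^ k := by
              gcongr
              linarith
      · intro g hg
        obtain ⟨γ, hγ, rfl⟩ := Finset.mem_image.1 hg
        have h5 := hTR γ hγ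
        rw [← hf γ] at h5
        change ‖θ (f γ) 0‖ ≤ _ at h5
        have h6 := norm_add₃_le (a := θ (f γ) x - θ (f γ) 0) (b := θ (f γ) 0) (c := -x)
        rw [sub_add_cancel, ← sub_eq_add_neg, hx, norm_neg] at h6
        linarith
  · have := h3 h0
    obtain ⟨C, hC⟩ := (Set.finite_range fun γ : θ.range => ‖γ.1 0‖).bddAbove
    refine Set.finite_univ_iff.1 ((hθ C).subset fun g _ => ?_)
    exact hC ⟨θ.rangeRestrict g, rfl⟩

end Growth

/-! ### Properness of hyperbolic space and of discrete group actions. -/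

section Discreteness

variable {n : ℕ}

instance : ProperSpace (HypSpace n) := by
  refine ProperSpace.of_seq_closedBall (l := atTop) (x := HypSpace.center (n := n))
    (r := fun m : ℕ => (m : ℝ))
    tendsto_natCast_atTop_atTop (Eventually.of_forall fun m => ?_)
  -- By `ht_eq` the hyperbolic ball of radius m is where 1 - |x|² ≥ δ, a compact Euclidean set on
  -- which the hyperbolic metric is continuous.
  set δ : ℝ := (Real.cosh ((m : ℝ) / 2) ^ 2)⁻¹ with hδ
  have hδ0 : 0 < δ := by have := Real.cosh_pos ((m : ℝ) / 2); positivity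
  set K := {z : EuclideanSpace ℝ (Fin n) | δ ≤ 1 - ‖z‖ ^ 2} with hK
  have hKc : IsCompact K := by
    refine (isCompact_closedBall (0 : EuclideanSpace ℝ (Fin n)) 1).of_isClosed_subset
      (isClosed_le continuous_const (by fun_prop)) fun z hz => ?_
    rw [mem_closedBall_zero_iff]
    have hz' : δ ≤ 1 - ‖z‖ ^ 2 := hz
    nlinarith [norm_nonneg z]
  have hK1 : ∀ z ∈ K, ‖z‖ < 1 := fun z hz => by
    have hz' : δ ≤ 1 - ‖z‖ ^ 2 := hz
    nlinarith [norm_nonneg z]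
  let f : K → HypSpace n := fun z => ⟨z, hK1 z z.2⟩
  have hf : Continuous f := by
    refine continuous_iff_continuousAt.2 fun z => ?_
    rw [ContinuousAt, tendsto_iff_dist_tendsto_zero]
    have h0 : √((1 - ‖(z : EuclideanSpace ℝ (Fin n))‖ ^ 2) *
        (1 - ‖(z : EuclideanSpace ℝ (Fin n))‖ ^ 2)) ≠ 0 := by
      have h1 : δ ≤ 1 - ‖(z : EuclideanSpace ℝ (Fin n))‖ ^ 2 := z.2
      have h2 : 0 < 1 - ‖(z : EuclideanSpace ℝ (Fin n))‖ ^ 2 := by linarith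
      positivity
    have h2 : ContinuousAt (fun y : K => 2 * Real.arsinh (dist (y : EuclideanSpace ℝ (Fin n)) z /
        √((1 - ‖(y : EuclideanSpace ℝ (Fin n))‖ ^ 2) *
        (1 - ‖(z : EuclideanSpace ℝ (Fin n))‖ ^ 2)))) z := by
      refine ContinuousAt.mul continuousAt_const (Real.continuous_arsinh.continuousAt.comp ?_)
      refine ContinuousAt.div (by fun_prop) (by fun_prop) h0
    have h3 := h2.tendsto
    simp only [dist_self, zero_div, Real.arsinh_zero, mul_zero] at h3
    exact h3
  have : CompactSpace K := isCompact_iff_compactSpace.1 hKc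
  refine (isCompact_range hf).of_isClosed_subset Metric.isClosed_closedBall fun x hx => ?_
  have h1 : δ ≤ x.ht := by
    rw [HypSpace.ht_eq, hδ]
    have h2 : dist HypSpace.center x ≤ (m : ℝ) := Metric.mem_closedBall'.1 hx
    have h3 := Real.cosh_pos (dist (HypSpace.center (n := n)) x / 2)
    gcongr
    rw [Real.cosh_le_cosh, abs_of_nonneg (by positivity), abs_of_nonneg (by positivity)]
    linarith
  exact ⟨⟨x.pt, h1⟩, rfl⟩

/-- Discrete groups of isometries of hyperbolic space act properly discontinuously. -/
lemma finite_dist_le_of_discreteTopology (P : Subgroup (HypSpace n ≃ᵢ HypSpace n))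
    [DiscreteTopology P] (o : HypSpace n) (R : ℝ) : {p : P | dist o (p.1 o) ≤ R}.Finite := by
  by_contra hinf
  set S := {p : P | dist o (p.1 o) ≤ R}
  -- A non-principal ultrafilter on S makes all orbit maps converge pointwise. Then p⁻¹q tends to 1
  -- uniformly on compact sets as p and q run along it, so p⁻¹q = 1 eventually by discreteness, and
  -- the ultrafilter would contain a set with at most one point.
  have hne : (cofinite ⊓ 𝓟 S).NeBot := by
    rw [← frequently_mem_iff_neBot]
    exact frequently_cofinite_iff_infinite.2 hinf
  set U : Ultrafilter P := Ultrafilter.of (cofinite ⊓ 𝓟 S)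
  have hU : (U : Filter P) ≤ cofinite ⊓ 𝓟 S := Ultrafilter.of_le _
  have hlim : ∀ x : HypSpace n, ∃ y, Tendsto (fun p : P => p.1 x) U (𝓝 y) := by
    intro x
    have h1 : Metric.closedBall o (R + dist o x) ∈ U.map fun p : P => p.1 x := by
      have h2 : S ∈ U := hU.trans inf_le_right (mem_principal_self S)
      refine Ultrafilter.mem_map.2 (Filter.mem_of_superset h2 fun p hp => ?_)
      have h3 := dist_triangle o (p.1 o) (p.1 x)
      have hp' : dist o (p.1 o) ≤ R := hp
      rw [p.1.dist_eq] at h3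
      exact Metric.mem_closedBall'.2 (by linarith)
    obtain ⟨y, -, hy⟩ := (isCompact_closedBall o (R + dist o x)).ultrafilter_le_nhds
      (U.map fun p : P => p.1 x) (le_principal_iff.2 h1)
    exact ⟨y, hy⟩
  have hcauchy : ∀ (x : HypSpace n) (ε : ℝ), 0 < ε →
      ∀ᶠ pq : P × P in (U : Filter P) ×ˢ (U : Filter P), dist (pq.1.1 x) (pq.2.1 x) < ε := by
    intro x ε hε
    obtain ⟨y, hy⟩ := hlim x
    have h1 := (hy.comp tendsto_fst).dist (hy.comp (tendsto_snd (f := (U : Filter P))))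
    rw [dist_self] at h1
    exact h1.eventually (gt_mem_nhds hε)
  have hT : Tendsto (fun pq : P × P => pq.1⁻¹ * pq.2) ((U : Filter P) ×ˢ (U : Filter P))
      (𝓝 (1 : P)) := by
    rw [Topology.IsInducing.subtypeVal.tendsto_nhds_iff]
    have hind : Topology.IsInducing fun g : HypSpace n ≃ᵢ HypSpace n =>
      (⟨g, g.continuous⟩ : C(HypSpace n, HypSpace n)) := ⟨rfl⟩
    rw [hind.tendsto_nhds_iff, ContinuousMap.tendsto_iff_forall_isCompact_tendstoUniformlyOn]
    intro K hK
    rw [Metric.tendstoUniformlyOn_iff]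
    intro ε hε
    obtain ⟨t, -, htf, hcov⟩ := Metric.finite_approx_of_totallyBounded hK.totallyBounded (ε / 3)
      (by positivity)
    have h1 : ∀ᶠ pq : P × P in (U : Filter P) ×ˢ (U : Filter P),
        ∀ x ∈ t, dist (pq.1.1 x) (pq.2.1 x) < ε / 3 :=
      (Filter.eventually_all_finite htf).2 fun x _ => hcauchy x _ (by positivity)
    filter_upwards [h1] with pq hpq x hx
    obtain ⟨y, hy, hxy⟩ := Set.mem_iUnion₂.1 (hcov hx)
    change dist x ((pq.1.1⁻¹ * pq.2.1) x) < ε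
    have e : pq.1.1 ((pq.1.1⁻¹ * pq.2.1) x) = pq.2.1 x := by
      change (pq.1.1 * (pq.1.1⁻¹ * pq.2.1)) x = _
      rw [mul_inv_cancel_left]
    rw [← pq.1.1.dist_eq, e]
    have h2 := dist_triangle4 (pq.1.1 x) (pq.1.1 y) (pq.2.1 y) (pq.2.1 x)
    rw [pq.1.1.dist_eq, pq.2.1.dist_eq, dist_comm y x] at h2
    have h3 := hpq y hy
    have h4 : dist x y < ε / 3 := hxy
    linarith
  have hT1 : ∀ᶠ pq : P × P in (U : Filter P) ×ˢ (U : Filter P), pq.1⁻¹ * pq.2 = 1 := by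
    rw [nhds_discrete] at hT
    exact tendsto_pure.1 hT
  obtain ⟨A, hA, hA1⟩ := (eventually_prod_self_iff (r := fun p q : P => p⁻¹ * q = 1)).1 hT1
  have hsub : A.Subsingleton := fun p hp q hq => (inv_mul_eq_one.1 (hA1 p hp q hq))
  have hc : Aᶜ ∈ (U : Filter P) := hU.trans inf_le_left hsub.finite.compl_mem_cofinite
  have := U.neBot
  exact (this.nonempty_of_mem (inter_mem hA hc)).elim fun p hp => hp.2 hp.1

end Discreteness

/-! ### Isometries fixing a boundary point, seen after inversion at that point. -/

section Horosphere

variable {n : ℕ}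

namespace HypSpace

lemma dist_sq_mul_ht (g : HypSpace n ≃ᵢ HypSpace n) (x y : HypSpace n) :
    dist (g x).pt (g y).pt ^ 2 * (x.ht * y.ht) = dist x.pt y.pt ^ 2 * ((g x).ht * (g y).ht) := by
  have hx := x.ht_pos
  have hy := y.ht_pos
  have hgx := (g x).ht_pos
  have hgy := (g y).ht_pos
  have h1 : dist (g x).pt (g y).pt / √((g x).ht * (g y).ht) =
      dist x.pt y.pt / √(x.ht * y.ht) := by
    rw [← sinh_half_hdist, ← sinh_half_hdist]
    have h2 : hdist (g x) (g y) = hdist x y := g.dist_eq x y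
    rw [h2]
  have h2 := congrArg (fun t : ℝ => t ^ 2) h1
  simp only [div_pow] at h2
  rw [Real.sq_sqrt (by positivity), Real.sq_sqrt (by positivity),
    div_eq_div_iff (by positivity) (by positivity)] at h2
  exact h2

lemma pt_ne_boundary (x : HypSpace n) (ξ : HypBoundary n) : x.pt ≠ ξ.pt := by
  intro h
  have := x.norm_lt
  rw [h, ξ.norm_eq] at this
  exact lt_irrefl _ this

lemma dist_pos_boundary (x : HypSpace n) (ξ : HypBoundary n) : 0 < dist x.pt ξ.pt :=
  dist_pos.2 (x.pt_ne_boundary ξ)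

end HypSpace

namespace HypBoundary

lemma tendsto_pt (ξ : HypBoundary n) : Tendsto HypSpace.pt (approach ξ) (𝓝 ξ.pt) := tendsto_comap

lemma tendsto_pt_smul (g : HypSpace n ≃ᵢ HypSpace n) (ξ : HypBoundary n) :
    Tendsto (fun x => (g x).pt) (approach ξ) (𝓝 (g • ξ).pt) :=
  tendsto_comap_iff.1 (tendsto_smul g ξ)

lemma dist_pt_pos {ξ η : HypBoundary n} (h : ξ ≠ η) : 0 < dist ξ.pt η.pt :=
  dist_pos.2 fun e => h (HypBoundary.ext e)

/-- The conformal factor of an isometry on the boundary. -/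
lemma exists_conformal_factor (g : HypSpace n ≃ᵢ HypSpace n) : ∃ κ : HypBoundary n → ℝ,
    (∀ ξ, 0 < κ ξ) ∧
    (∀ x ξ, dist (g x).pt (g • ξ).pt ^ 2 * x.ht = κ ξ * dist x.pt ξ.pt ^ 2 * (g x).ht) ∧
    ∀ ξ η : HypBoundary n,
      dist (g • ξ).pt (g • η).pt ^ 2 = κ ξ * κ η * dist ξ.pt η.pt ^ 2 := by
  set c : HypSpace n := HypSpace.center
  -- This is the limit of (1 - |g y|²)/(1 - |y|²) as y → ξ, read off from the invariance of the
  -- distance between y and the centre.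
  set κ : HypBoundary n → ℝ := fun ξ =>
    dist (g c).pt (g • ξ).pt ^ 2 * c.ht / (dist c.pt ξ.pt ^ 2 * (g c).ht) with hκ
  have hc := c.ht_pos
  have hgc := (g c).ht_pos
  have hκ0 : ∀ ξ, 0 < κ ξ := fun ξ => by
    have h1 := c.dist_pos_boundary ξ
    have h2 := (g c).dist_pos_boundary (g • ξ)
    simp only [hκ]
    positivity
  have hlim : ∀ ξ, Tendsto (fun y : HypSpace n => (g y).ht / y.ht) (approach ξ) (𝓝 (κ ξ)) := by
    intro ξ
    have h1 : Tendsto (fun y : HypSpace n =>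
        dist (g c).pt (g y).pt ^ 2 * c.ht / (dist c.pt y.pt ^ 2 * (g c).ht)) (approach ξ)
        (𝓝 (κ ξ)) := by
      refine Tendsto.div ?_ ?_ ?_
      · exact ((tendsto_const_nhds.dist (tendsto_pt_smul g ξ)).pow 2).mul_const _
      · exact ((tendsto_const_nhds.dist (tendsto_pt ξ)).pow 2).mul_const _
      · have := c.dist_pos_boundary ξ
        positivity
    have h2 : ∀ᶠ y in approach ξ, dist c.pt y.pt ≠ 0 :=
      (tendsto_const_nhds.dist (tendsto_pt ξ)).eventually_ne (c.dist_pos_boundary ξ).ne'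
    refine h1.congr' ?_
    filter_upwards [h2] with y hy
    have hy0 := y.ht_pos
    rw [div_eq_div_iff (by positivity) (by positivity)]
    linear_combination HypSpace.dist_sq_mul_ht g c y
  have hmix : ∀ (x : HypSpace n) ξ,
      dist (g x).pt (g • ξ).pt ^ 2 * x.ht = κ ξ * dist x.pt ξ.pt ^ 2 * (g x).ht := by
    intro x ξ
    have h1 : Tendsto (fun y : HypSpace n => dist (g x).pt (g y).pt ^ 2 * x.ht) (approach ξ)
        (𝓝 (dist (g x).pt (g • ξ).pt ^ 2 * x.ht)) :=
      ((tendsto_const_nhds.dist (tendsto_pt_smul g ξ)).pow 2).mul_const _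
    have h2 : Tendsto (fun y : HypSpace n => (g y).ht / y.ht * dist x.pt y.pt ^ 2 * (g x).ht)
        (approach ξ) (𝓝 (κ ξ * dist x.pt ξ.pt ^ 2 * (g x).ht)) :=
      ((hlim ξ).mul ((tendsto_const_nhds.dist (tendsto_pt ξ)).pow 2)).mul_const _
    refine tendsto_nhds_unique h1 (h2.congr fun y => ?_)
    have hy0 := y.ht_pos
    have h3 := HypSpace.dist_sq_mul_ht g x y
    field_simp
    linear_combination -h3
  refine ⟨κ, hκ0, hmix, fun ξ η => ?_⟩
  have h1 : Tendsto (fun x : HypSpace n => dist (g x).pt (g • η).pt ^ 2) (approach ξ)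
      (𝓝 (dist (g • ξ).pt (g • η).pt ^ 2)) :=
    ((tendsto_pt_smul g ξ).dist tendsto_const_nhds).pow 2
  have h2 : Tendsto (fun x : HypSpace n => (g x).ht / x.ht * κ η * dist x.pt η.pt ^ 2)
      (approach ξ) (𝓝 (κ ξ * κ η * dist ξ.pt η.pt ^ 2)) :=
    ((hlim ξ).mul_const _).mul (((tendsto_pt ξ).dist tendsto_const_nhds).pow 2)
  refine tendsto_nhds_unique h1 (h2.congr fun x => ?_)
  have hx0 := x.ht_pos
  have h3 := hmix x η
  field_simp
  linear_combination -h3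

/-- The Euclidean distance after inversion in a sphere centred at a boundary point. -/
noncomputable def invDist (w : HypBoundary n) (a b : EuclideanSpace ℝ (Fin n)) : ℝ :=
  dist a b / (dist a w.pt * dist b w.pt)

lemma invDist_comm (w : HypBoundary n) (a b : EuclideanSpace ℝ (Fin n)) :
    invDist w a b = invDist w b a := by
  rw [invDist, invDist, dist_comm, mul_comm]

lemma invDist_nonneg (w : HypBoundary n) (a b : EuclideanSpace ℝ (Fin n)) : 0 ≤ invDist w a b := by
  unfold invDist; positivity

/-- Ptolemy's inequality for a, b, c, w, divided by the product of the distances to w. -/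
lemma invDist_triangle (w : HypBoundary n) {a b c : EuclideanSpace ℝ (Fin n)} (ha : a ≠ w.pt)
    (hb : b ≠ w.pt) (hc : c ≠ w.pt) : invDist w a c ≤ invDist w a b + invDist w b c := by
  have ha' := dist_pos.2 ha
  have hb' := dist_pos.2 hb
  have hc' := dist_pos.2 hc
  have h := EuclideanGeometry.mul_dist_le_mul_dist_add_mul_dist a b c w.pt
  unfold invDist
  rw [div_add_div _ _ (by positivity) (by positivity), div_le_div_iff₀ (by positivity)
    (by positivity)]
  have h1 := mul_le_mul_of_nonneg_left h
    (by positivity : 0 ≤ dist a w.pt * dist b w.pt * dist c w.pt)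
  nlinarith

/-- The height of a point above the boundary after inversion in a sphere centred at `w`. -/
noncomputable def horoHeight (w : HypBoundary n) (x : HypSpace n) : ℝ := x.ht / dist x.pt w.pt ^ 2

lemma horoHeight_pos (w : HypBoundary n) (x : HypSpace n) : 0 < horoHeight w x := by
  have := x.ht_pos
  have := x.dist_pos_boundary w
  unfold horoHeight
  positivity

/-- The factor by which an isometry that fixes `w` scales the heights with respect to `w`. -/
noncomputable def horoScale (w : HypBoundary n) (g : HypSpace n ≃ᵢ HypSpace n) : ℝ :=
  horoHeight w (g HypSpace.center) / horoHeight w HypSpace.center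

lemma horoScale_pos (w : HypBoundary n) (g : HypSpace n ≃ᵢ HypSpace n) : 0 < horoScale w g :=
  div_pos (horoHeight_pos _ _) (horoHeight_pos _ _)

lemma smul_ne_of_fixed {w : HypBoundary n} {g : HypSpace n ≃ᵢ HypSpace n} (hg : g • w = w)
    {ξ : HypBoundary n} (h : ξ ≠ w) : g • ξ ≠ w := fun e => h (by
  rw [← hg] at e
  exact MulAction.injective g e)

/-- The conformal factors at the individual points cancel between numerator and denominator, leaving
only the inverse of the factor at w. -/
lemma similarity_of_fixed {w : HypBoundary n} {g : HypSpace n ≃ᵢ HypSpace n} (hg : g • w = w) :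
    (∀ x, horoHeight w (g x) = horoScale w g * horoHeight w x) ∧
    (∀ ξ η, ξ ≠ w → η ≠ w →
      invDist w (g • ξ).pt (g • η).pt = horoScale w g * invDist w ξ.pt η.pt) ∧
    ∀ (x : HypSpace n) (ξ : HypBoundary n), ξ ≠ w →
      invDist w (g x).pt (g • ξ).pt = horoScale w g * invDist w x.pt ξ.pt := by
  obtain ⟨κ, hκ0, h1, h2⟩ := exists_conformal_factor g
  have hw := hκ0 w
  have hh : ∀ x, horoHeight w (g x) = (κ w)⁻¹ * horoHeight w x := by
    intro x
    have h3 := h1 x w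
    rw [hg] at h3
    have h4 := x.dist_pos_boundary w
    have h5 := (g x).dist_pos_boundary w
    unfold horoHeight
    field_simp
    linear_combination -h3
  have hs : horoScale w g = (κ w)⁻¹ := by
    have h4 := horoHeight_pos w HypSpace.center
    rw [horoScale, hh]
    field_simp
  rw [hs]
  have hb : ∀ ξ : HypBoundary n, dist (g • ξ).pt w.pt ^ 2 = κ ξ * κ w * dist ξ.pt w.pt ^ 2 := by
    intro ξ
    have := h2 ξ w
    rwa [hg] at this
  refine ⟨hh, fun ξ η hξ hη => ?_, fun x ξ hξ => ?_⟩
  · have h3 := dist_pt_pos hξ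
    have h4 := dist_pt_pos hη
    have h5 := hκ0 ξ
    have h6 := hκ0 η
    rw [← sq_eq_sq₀ (invDist_nonneg _ _ _) (by have := invDist_nonneg w ξ.pt η.pt; positivity)]
    unfold invDist
    rw [div_pow, mul_pow (dist (g • ξ).pt w.pt), hb, hb, h2, mul_pow, div_pow]
    field_simp
  · have h3 := dist_pt_pos hξ
    have h4 := x.dist_pos_boundary w
    have h4' := (g x).dist_pos_boundary w
    have h5 := hκ0 ξ
    have h6 := x.ht_pos
    have h7 := (g x).ht_pos
    have h8 := h1 x ξ
    have h9 := h1 x w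
    rw [hg] at h9
    rw [← sq_eq_sq₀ (invDist_nonneg _ _ _) (by have := invDist_nonneg w x.pt ξ.pt; positivity)]
    unfold invDist
    rw [div_pow, mul_pow (dist (g x).pt w.pt), hb, mul_pow, div_pow]
    have e1 : dist (g x).pt (g • ξ).pt ^ 2 = κ ξ * dist x.pt ξ.pt ^ 2 * (g x).ht / x.ht := by
      rw [← h8]; field_simp
    have e2 : dist (g x).pt w.pt ^ 2 = κ w * dist x.pt w.pt ^ 2 * (g x).ht / x.ht := by
      rw [← h9]; field_simp
    rw [e1, e2]
    field_simp

lemma horoScale_mul {w : HypBoundary n} {g : HypSpace n ≃ᵢ HypSpace n} (hg : g • w = w)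
    (h : HypSpace n ≃ᵢ HypSpace n) : horoScale w (g * h) = horoScale w g * horoScale w h := by
  have h1 := (similarity_of_fixed hg).1 (h HypSpace.center)
  have h2 : (g * h) HypSpace.center = g (h HypSpace.center) := rfl
  rw [horoScale, h2, h1, horoScale.eq_def w h, mul_div_assoc]

lemma horoScale_one (w : HypBoundary n) : horoScale w 1 = 1 :=
  div_self (horoHeight_pos w HypSpace.center).ne'

lemma horoScale_inv {w : HypBoundary n} {g : HypSpace n ≃ᵢ HypSpace n} (hg : g • w = w) :
    horoScale w g⁻¹ = (horoScale w g)⁻¹ := by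
  refine eq_inv_of_mul_eq_one_right ?_
  rw [← horoScale_mul hg, mul_inv_cancel, horoScale_one]

lemma pow_smul_of_fixed {w : HypBoundary n} {g : HypSpace n ≃ᵢ HypSpace n} (hg : g • w = w)
    (k : ℕ) : g ^ k • w = w := by
  induction k with
  | zero => rw [pow_zero, one_smul]
  | succ k ih => rw [pow_succ, mul_smul, hg, ih]

lemma horoScale_pow {w : HypBoundary n} {g : HypSpace n ≃ᵢ HypSpace n} (hg : g • w = w)
    (k : ℕ) : horoScale w (g ^ k) = horoScale w g ^ k := by
  induction k with
  | zero => rw [pow_zero, pow_zero, horoScale_one]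
  | succ k ih => rw [pow_succ, pow_succ, horoScale_mul (pow_smul_of_fixed hg k), ih]

/-- The upper half-space form of the distance formula; the distances to w cancel. -/
lemma sinh_half_dist_eq (w : HypBoundary n) (x y : HypSpace n) :
    Real.sinh (dist x y / 2) = invDist w x.pt y.pt / √(horoHeight w x * horoHeight w y) := by
  have h : Real.sinh (dist x y / 2) = dist x.pt y.pt / √(x.ht * y.ht) :=
    HypSpace.sinh_half_hdist x y
  have hx := x.ht_pos
  have hy := y.ht_pos
  have hx' := x.dist_pos_boundary w
  have hy' := y.dist_pos_boundary w
  have e : horoHeight w x * horoHeight w y =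
      x.ht * y.ht / (dist x.pt w.pt * dist y.pt w.pt) ^ 2 := by
    unfold horoHeight
    field_simp
  rw [h, e, Real.sqrt_div (by positivity), Real.sqrt_sq (by positivity), invDist]
  field_simp

/-! ### Stereographic coordinates -/

/-- The inverse of the stereographic projection from `w`. -/
noncomputable def stereoInv (w : HypBoundary n) (y : (ℝ ∙ w.pt)ᗮ) : HypBoundary n :=
  ⟨stereoInvFun w.norm_eq y, norm_eq_of_mem_sphere _⟩

/-- The stereographic projection from `w`. -/
noncomputable def stereo (w ξ : HypBoundary n) : (ℝ ∙ w.pt)ᗮ := stereoToFun w.pt ξ.pt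

lemma stereo_stereoInv (w : HypBoundary n) (y : (ℝ ∙ w.pt)ᗮ) : stereo w (stereoInv w y) = y :=
  stereo_right_inv w.norm_eq y

lemma stereoInv_stereo {w ξ : HypBoundary n} (h : ξ ≠ w) : stereoInv w (stereo w ξ) = ξ := by
  apply HypBoundary.ext
  have h1 := stereo_left_inv w.norm_eq (x := ⟨ξ.pt, mem_sphere_zero_iff_norm.2 ξ.norm_eq⟩)
    fun e => h (HypBoundary.ext e)
  exact congrArg Subtype.val h1

lemma stereoInv_ne (w : HypBoundary n) (y : (ℝ ∙ w.pt)ᗮ) : stereoInv w y ≠ w := fun h =>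
  stereoInvFun_ne_north_pole w.norm_eq y (Subtype.ext (congrArg HypBoundary.pt h))

lemma dist_pt_sq (ξ η : HypBoundary n) : dist ξ.pt η.pt ^ 2 = 2 - 2 * inner ℝ ξ.pt η.pt := by
  rw [dist_eq_norm, norm_sub_sq_real, ξ.norm_eq, η.norm_eq]
  ring

lemma stereoInv_pt (w : HypBoundary n) (y : (ℝ ∙ w.pt)ᗮ) : (stereoInv w y).pt =
    (‖y‖ ^ 2 + 4)⁻¹ • ((4 : ℝ) • (y : EuclideanSpace ℝ (Fin n)) + (‖y‖ ^ 2 - 4) • w.pt) :=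
  stereoInvFun_apply w.norm_eq y

lemma inner_coe_pt (w : HypBoundary n) (y : (ℝ ∙ w.pt)ᗮ) :
    inner ℝ (y : EuclideanSpace ℝ (Fin n)) w.pt = 0 :=
  Submodule.mem_orthogonal_singleton_iff_inner_left.1 y.2

lemma dist_stereoInv_self_sq (w : HypBoundary n) (y : (ℝ ∙ w.pt)ᗮ) :
    dist (stereoInv w y).pt w.pt ^ 2 = 16 / (‖y‖ ^ 2 + 4) := by
  have h0 : 0 < ‖y‖ ^ 2 + 4 := by positivity
  rw [dist_pt_sq, stereoInv_pt, real_inner_smul_left, inner_add_left, real_inner_smul_left,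
    real_inner_smul_left, inner_coe_pt, real_inner_self_eq_norm_sq, w.norm_eq]
  field_simp
  ring

lemma dist_stereoInv_sq (w : HypBoundary n) (y z : (ℝ ∙ w.pt)ᗮ) :
    dist (stereoInv w y).pt (stereoInv w z).pt ^ 2 =
      16 * ‖y - z‖ ^ 2 / ((‖y‖ ^ 2 + 4) * (‖z‖ ^ 2 + 4)) := by
  have hy : 0 < ‖y‖ ^ 2 + 4 := by positivity
  have hz : 0 < ‖z‖ ^ 2 + 4 := by positivity
  have h1 : inner ℝ (y : EuclideanSpace ℝ (Fin n)) (z : EuclideanSpace ℝ (Fin n)) = inner ℝ y z :=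
    rfl
  rw [dist_pt_sq, stereoInv_pt, stereoInv_pt, real_inner_smul_left, real_inner_smul_right,
    inner_add_left, inner_add_right, inner_add_right, real_inner_smul_left, real_inner_smul_right,
    real_inner_smul_left, real_inner_smul_right, real_inner_smul_left, real_inner_smul_right,
    real_inner_smul_left, real_inner_smul_right, inner_coe_pt, real_inner_comm _ w.pt, inner_coe_pt,
    real_inner_self_eq_norm_sq, w.norm_eq, h1, norm_sub_sq_real]
  field_simp
  ring

/-- This stereographic projection is, up to a translation, inversion of radius 2 at w, whence the
factor 2² = 4. -/
lemma invDist_stereoInv (w : HypBoundary n) (y z : (ℝ ∙ w.pt)ᗮ) :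
    invDist w (stereoInv w y).pt (stereoInv w z).pt = ‖y - z‖ / 4 := by
  rw [← sq_eq_sq₀ (invDist_nonneg _ _ _) (by positivity), invDist, div_pow, mul_pow,
    dist_stereoInv_sq, dist_stereoInv_self_sq, dist_stereoInv_self_sq]
  field_simp
  norm_num
  ring

lemma norm_stereo_sub {w ξ η : HypBoundary n} (hξ : ξ ≠ w) (hη : η ≠ w) :
    ‖stereo w ξ - stereo w η‖ = 4 * invDist w ξ.pt η.pt := by
  have := invDist_stereoInv w (stereo w ξ) (stereo w η)
  rw [stereoInv_stereo hξ, stereoInv_stereo hη] at this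
  linarith

end HypBoundary

end Horosphere

/-! ### Discrete parabolic groups as groups of Euclidean isometries. -/

section Parabolic

variable {n : ℕ}

namespace HypBoundary

/-- A strictly contracting isometry that fixes `w` has a second boundary fixed point. -/
lemma exists_fixed_of_horoScale_lt_one {w : HypBoundary n} {g : HypSpace n ≃ᵢ HypSpace n}
    (hg : g • w = w) (h1 : horoScale w g < 1) : ∃ a, a ≠ w ∧ g • a = a := by
  set f : (ℝ ∙ w.pt)ᗮ → (ℝ ∙ w.pt)ᗮ := fun y => stereo w (g • stereoInv w y) with hf
  have hfd : ∀ y z, dist (f y) (f z) = horoScale w g * dist y z := by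
    intro y z
    rw [dist_eq_norm, dist_eq_norm, hf, norm_stereo_sub (smul_ne_of_fixed hg (stereoInv_ne w y))
      (smul_ne_of_fixed hg (stereoInv_ne w z)),
      (similarity_of_fixed hg).2.1 _ _ (stereoInv_ne w y) (stereoInv_ne w z), invDist_stereoInv]
    ring
  have hc : ContractingWith (⟨horoScale w g, (horoScale_pos w g).le⟩ : NNReal) f :=
    ⟨by exact_mod_cast h1, LipschitzWith.of_dist_le_mul fun y z => (hfd y z).le⟩
  obtain ⟨y, hy⟩ : ∃ y, f y = y := ⟨_, hc.fixedPoint_isFixedPt⟩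
  refine ⟨stereoInv w y, stereoInv_ne _ _, ?_⟩
  nth_rewrite 2 [← hy]
  rw [hf, stereoInv_stereo (smul_ne_of_fixed hg (stereoInv_ne _ _))]

/-- The elements of a discrete parabolic group preserve the horospheres. -/
lemma horoScale_eq_one {P : Subgroup (HypSpace n ≃ᵢ HypSpace n)} [DiscreteTopology P]
    {w : HypBoundary n} (hw : ∀ p ∈ P, p • w = w)
    (huniq : ∀ v : HypBoundary n, (∀ p ∈ P, p • v = v) → v = w) :
    ∀ p ∈ P, horoScale w p = 1 := by
  have key : ∀ p ∈ P, ¬ horoScale w p < 1 := by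
    intro g hgP hlt
    have hg := hw g hgP
    obtain ⟨a, haw, hga⟩ := exists_fixed_of_horoScale_lt_one hg hlt
    obtain ⟨h, hhP, hha⟩ : ∃ h ∈ P, h • a ≠ a := by
      by_contra! hcon
      exact haw (huniq a hcon)
    have hh := hw h hhP
    have hgk := fun k => pow_smul_of_fixed hg k
    have hgka : ∀ k, g ^ k • a = a := fun k => by
      induction k with
      | zero => rw [pow_zero, one_smul]
      | succ k ih => rw [pow_succ, mul_smul, hga, ih]
    have hinv : ∀ k, (g ^ k)⁻¹ • a = a := fun k => by
      nth_rewrite 1 [← hgka k]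
      rw [← mul_smul, inv_mul_cancel, one_smul]
    have hinvw : ∀ k, (g ^ k)⁻¹ • w = w := fun k => by
      nth_rewrite 1 [← hgk k]
      rw [← mul_smul, inv_mul_cancel, one_smul]
    have hfP : ∀ k : ℕ, g ^ k * h * (g ^ k)⁻¹ ∈ P := fun k =>
      P.mul_mem (P.mul_mem (P.pow_mem hgP k) hhP) (P.inv_mem (P.pow_mem hgP k))
    -- These conjugates displace a by lam^k D in `invDist`, so they are pairwise distinct; all have
    -- the scale of h.
    let f : ℕ → P := fun k => ⟨g ^ k * h * (g ^ k)⁻¹, hfP k⟩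
    set lam := horoScale w g with hlam
    have hlam0 : 0 < lam := horoScale_pos w g
    set D := invDist w a.pt (h • a).pt with hD
    have hhaw : h • a ≠ w := smul_ne_of_fixed hh haw
    have hD0 : 0 < D := by
      have h1 := dist_pt_pos (Ne.symm hha)
      have h2 := dist_pt_pos haw
      have h3 := dist_pt_pos hhaw
      rw [hD, invDist]
      positivity
    have hfa : ∀ k, (f k).1 • a = g ^ k • h • a := fun k => by
      change (g ^ k * h * (g ^ k)⁻¹) • a = _
      rw [mul_smul, mul_smul, hinv]
    have hfD : ∀ k, invDist w a.pt ((f k).1 • a).pt = lam ^ k * D := fun k => by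
      have h1 := (similarity_of_fixed (hgk k)).2.1 a (h • a) haw hhaw
      rwa [hgka, ← hfa, horoScale_pow hg] at h1
    have hinj : Function.Injective f := by
      intro k j hkj
      have h1 := hfD k
      rw [hkj, hfD j] at h1
      exact (pow_right_injective₀ hlam0 hlt.ne) (mul_right_cancel₀ hD0.ne' h1).symm
    set o : HypSpace n := HypSpace.center
    set μ := horoScale w h with hμ
    have hμ0 : 0 < μ := horoScale_pos w h
    have hfs : ∀ k, horoScale w (f k).1 = μ := fun k => by
      change horoScale w (g ^ k * h * (g ^ k)⁻¹) = μ
      have h1 : (g ^ k * h) • w = w := by rw [mul_smul, hh, hgk]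
      have h2 := horoScale_pos w (g ^ k)
      rw [horoScale_mul h1, horoScale_mul (hgk k), horoScale_inv (hgk k)]
      field_simp
      rfl
    set b := invDist w o.pt a.pt with hb
    -- The path from o through a and (f k) a to (f k) o has `invDist` length at most b + D + μ b,
    -- uniformly in k.
    set K := (b + D + μ * b) / √(horoHeight w o * (μ * horoHeight w o)) with hK
    have hbound : ∀ k, dist o ((f k).1 o) ≤ 2 * Real.arsinh K := by
      intro k
      have hfw := hw _ (f k).2
      have h1 := sinh_half_dist_eq w o ((f k).1 o)
      have h2 := (similarity_of_fixed hfw).1 o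
      have h3 := (similarity_of_fixed hfw).2.2 o a haw
      rw [hfs k] at h2 h3
      rw [h2] at h1
      have n1 := o.pt_ne_boundary w
      have n2 := ((f k).1 o).pt_ne_boundary w
      have n3 : a.pt ≠ w.pt := fun e => haw (HypBoundary.ext e)
      have n4 : ((f k).1 • a).pt ≠ w.pt := fun e =>
        smul_ne_of_fixed hfw haw (HypBoundary.ext e)
      have t1 := invDist_triangle w n1 n3 n2
      have t2 := invDist_triangle w n3 n4 n2
      rw [invDist_comm w ((f k).1 • a).pt, h3, hfD k] at t2
      have h4 : lam ^ k * D ≤ D := mul_le_of_le_one_left hD0.le (pow_le_one₀ hlam0.le hlt.le)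
      have h5 : Real.sinh (dist o ((f k).1 o) / 2) ≤ K := by
        rw [h1, hK]
        gcongr
        linarith
      have h6 := Real.arsinh_le_arsinh.2 h5
      rw [Real.arsinh_sinh] at h6
      linarith
    exact Set.infinite_of_injective_forall_mem hinj hbound
      (finite_dist_le_of_discreteTopology P o (2 * Real.arsinh K))
  intro p hp
  refine le_antisymm ?_ (not_lt.1 (key p hp))
  by_contra! h1
  refine key p⁻¹ (P.inv_mem hp) ?_
  rw [horoScale_inv (hw p hp)]
  exact inv_lt_one_of_one_lt₀ h1

/-- A group that fixes `w` and preserves the horospheres at `w` acts on the complement of `w` by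
affine isometries in stereographic coordinates. -/
lemma exists_affine_action {P : Subgroup (HypSpace n ≃ᵢ HypSpace n)} {w : HypBoundary n}
    (hw : ∀ p ∈ P, p • w = w) (hs : ∀ p ∈ P, horoScale w p = 1) :
    ∃ θ : P →* ((ℝ ∙ w.pt)ᗮ ≃ᵃⁱ[ℝ] (ℝ ∙ w.pt)ᗮ),
      ∀ p y, θ p y = stereo w (p.1 • stereoInv w y) := by
  let f : P → (ℝ ∙ w.pt)ᗮ → (ℝ ∙ w.pt)ᗮ := fun p y => stereo w (p.1 • stereoInv w y)
  have hf : ∀ p, Isometry (f p) := fun p => Isometry.of_dist_eq fun y z => by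
    have hp := hw p.1 p.2
    rw [dist_eq_norm, dist_eq_norm, norm_stereo_sub (smul_ne_of_fixed hp (stereoInv_ne w y))
      (smul_ne_of_fixed hp (stereoInv_ne w z)),
      (similarity_of_fixed hp).2.1 _ _ (stereoInv_ne w y) (stereoInv_ne w z), invDist_stereoInv,
      hs p.1 p.2]
    ring
  have hmul : ∀ p q y, f (p * q) y = f p (f q y) := fun p q y => by
    change stereo w ((p.1 * q.1) • stereoInv w y) = stereo w (p.1 • stereoInv w (stereo w _))
    rw [stereoInv_stereo (smul_ne_of_fixed (hw q.1 q.2) (stereoInv_ne w y)), mul_smul]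
  have hone : ∀ y, f 1 y = y := fun y => by
    change stereo w ((1 : HypSpace n ≃ᵢ HypSpace n) • stereoInv w y) = y
    rw [one_smul, stereo_stereoInv]
  -- Surjective isometries of real normed spaces are affine, by Mazur–Ulam.
  let F : P → (ℝ ∙ w.pt)ᗮ ≃ᵃⁱ[ℝ] (ℝ ∙ w.pt)ᗮ := fun p =>
    (IsometryEquiv.mk' (f p) (f p⁻¹) (fun y => by rw [← hmul, mul_inv_cancel, hone])
      (hf p)).toRealAffineIsometryEquiv
  have hF : ∀ p y, F p y = f p y := fun p y =>
    congrFun (IsometryEquiv.coeFn_toRealAffineIsometryEquiv _) y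
  refine ⟨⟨⟨F, ?_⟩, ?_⟩, hF⟩
  · ext1 y
    rw [hF, hone]
    rfl
  · intro p q
    ext1 y
    rw [hF, hmul, mul_apply_apply, hF, hF]

end HypBoundary

/-- A finite group of affine isometries has a fixed point. -/
lemma exists_fixed_of_finite {E : Type*} [NormedAddCommGroup E] [InnerProductSpace ℝ E]
    {G : Type*} [Group G] [Finite G] (θ : G →* (E ≃ᵃⁱ[ℝ] E)) : ∃ x, ∀ g, θ g x = x := by
  have := Fintype.ofFinite G
  have hN : (Fintype.card G : ℝ) ≠ 0 := by exact_mod_cast Fintype.card_ne_zero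
  -- The barycentre of the orbit of the origin.
  refine ⟨(Fintype.card G : ℝ)⁻¹ • ∑ g, θ g 0, fun g => ?_⟩
  rw [apply_eq_rotPart_add, map_smul, map_sum]
  have h1 : θ g 0 = (Fintype.card G : ℝ)⁻¹ • ∑ _h : G, θ g 0 := by
    rw [Finset.sum_const, Finset.card_univ, ← Nat.cast_smul_eq_nsmul ℝ, inv_smul_smul₀ hN]
  rw [h1, ← smul_add, ← Finset.sum_add_distrib]
  congr 1
  refine Fintype.sum_equiv (Equiv.mulLeft g) _ _ fun h => ?_
  rw [← apply_eq_rotPart_add, Equiv.coe_mulLeft, map_mul, mul_apply_apply]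

namespace HypBoundary

/-- Displacements of the reference point of hyperbolic space against displacements on the
boundary. -/
lemma exists_exp_dist_bounds {P : Subgroup (HypSpace n ≃ᵢ HypSpace n)} {w : HypBoundary n}
    (hw : ∀ p ∈ P, p • w = w) (hs : ∀ p ∈ P, horoScale w p = 1) (o : HypSpace n)
    {ξ : HypBoundary n} (hξ : ξ ≠ w) :
    ∃ C : ℝ, 0 < C ∧ ∀ p ∈ P, Real.exp (dist o (p o) / 2) ≤ C * (1 + ‖stereo w (p • ξ)‖) ∧
      1 + ‖stereo w (p • ξ)‖ ≤ C * Real.exp (dist o (p o) / 2) := by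
  set H := horoHeight w o with hH
  have hH0 : 0 < H := horoHeight_pos w o
  set b := invDist w o.pt ξ.pt with hb
  have hb0 : 0 ≤ b := invDist_nonneg _ _ _
  set x := ‖stereo w ξ‖ with hx
  have hx0 : 0 ≤ x := norm_nonneg _
  set A := 2 * (2 * b + x + 1) / H with hA
  have hA0 : 0 ≤ A := by positivity
  refine ⟨1 + A + (x + 8 * b + 4 * H), by positivity, fun p hp => ?_⟩
  have hpw := hw p hp
  obtain ⟨h1, -, h2⟩ := similarity_of_fixed hpw
  have h1 := h1 o
  have h2 := h2 o ξ hξ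
  rw [hs p hp, one_mul] at h1 h2
  have hpξ := smul_ne_of_fixed hpw hξ
  set y := ‖stereo w (p • ξ)‖ with hy
  have hy0 : 0 ≤ y := norm_nonneg _
  set e := Real.exp (dist o (p o) / 2) with he
  have he1 : 1 ≤ e := Real.one_le_exp (by positivity)
  set S := Real.sinh (dist o (p o) / 2) with hS
  -- Both points lie on one horosphere, so the square root of the product of heights is H. The
  -- displacements I of o and J of ξ then differ by at most 2b.
  have hS1 : S = invDist w o.pt (p o).pt / H := by
    rw [hS, sinh_half_dist_eq w, h1, Real.sqrt_mul_self hH0.le]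
  have hSe : S ≤ e := by
    have := Real.cosh_pos (dist o (p o) / 2)
    rw [he, ← Real.cosh_add_sinh]
    linarith
  have heS : e ≤ 1 + 2 * S := by
    have h3 : Real.exp (-(dist o (p o) / 2)) ≤ 1 := by
      rw [Real.exp_le_one_iff]
      have := dist_nonneg (x := o) (y := p o)
      linarith
    rw [hS, Real.sinh_eq]
    linarith
  have n1 := o.pt_ne_boundary w
  have n2 := (p o).pt_ne_boundary w
  have n3 : ξ.pt ≠ w.pt := fun e => hξ (HypBoundary.ext e)
  have n4 : (p • ξ).pt ≠ w.pt := fun e => hpξ (HypBoundary.ext e)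
  set I := invDist w o.pt (p o).pt with hI
  set J := invDist w ξ.pt (p • ξ).pt with hJ
  have t1 : I ≤ b + J + b := by
    have t1 := invDist_triangle w n1 n3 n2
    have t2 := invDist_triangle w n3 n4 n2
    rw [invDist_comm w (p • ξ).pt, h2] at t2
    linarith
  have t2 : J ≤ b + I + b := by
    have t1 := invDist_triangle w n3 n1 n4
    have t2 := invDist_triangle w n1 n2 n4
    rw [invDist_comm w ξ.pt o.pt] at t1
    rw [h2] at t2
    linarith
  have hJn : ‖stereo w ξ - stereo w (p • ξ)‖ = 4 * J := norm_stereo_sub hξ hpξ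
  have hJ1 : 4 * J ≤ x + y := by
    rw [← hJn]
    exact norm_sub_le _ _
  have hJ2 : y ≤ x + 4 * J := by
    have := norm_sub_norm_le (stereo w (p • ξ)) (stereo w ξ)
    rw [norm_sub_rev, hJn] at this
    linarith
  have hIS : I = H * S := by rw [hS1]; field_simp
  constructor
  · have h3 : S ≤ (2 * b + x + y) / H := by
      rw [le_div_iff₀ hH0]
      linarith
    have h4 : 2 * ((2 * b + x + y) / H) ≤ A * (1 + y) := by
      rw [hA, div_mul_eq_mul_div, ← mul_div_assoc]
      refine div_le_div_of_nonneg_right ?_ hH0.le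
      nlinarith
    nlinarith [mul_nonneg hA0 hy0]
  · nlinarith

/-- A group whose only boundary fixed point is `w` and that preserves the horospheres at `w` is
infinite. -/
lemma infinite_of_parabolic {P : Subgroup (HypSpace n ≃ᵢ HypSpace n)} {w : HypBoundary n}
    (hw : ∀ p ∈ P, p • w = w) (hs : ∀ p ∈ P, horoScale w p = 1)
    (huniq : ∀ v : HypBoundary n, (∀ p ∈ P, p • v = v) → v = w) : Infinite P := by
  by_contra hfin
  have := not_infinite_iff_finite.1 hfin
  obtain ⟨θ, hθ⟩ := exists_affine_action hw hs
  obtain ⟨x, hx⟩ := exists_fixed_of_finite θ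
  refine stereoInv_ne w x (huniq _ fun p hp => ?_)
  have h1 := hx ⟨p, hp⟩
  rw [hθ] at h1
  nth_rewrite 2 [← h1]
  rw [stereoInv_stereo (smul_ne_of_fixed (hw p hp) (stereoInv_ne w x))]

end HypBoundary

end Parabolic

/-! ### Box dimension and critical exponent from counting bounds. -/

section BoxCounting

lemma card_le_coverNumber {M : Type*} [MetricSpace M] {r : ℝ} (hr : 0 ≤ r) {F : Set M}
    (Q : Finset M) (hQF : ∀ x ∈ Q, x ∈ F) (hsep : ∀ x ∈ Q, ∀ y ∈ Q, x ≠ y → r < dist x y) :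
    (Q.card : ℕ∞) ≤ coverNumber r F := by
  refine le_iInf₂ fun C hC => ?_
  have h1 : ∀ x ∈ Q, ∃ U ∈ C, x ∈ U := fun x hx => hC.2 (hQF x hx)
  choose! f hfC hf using h1
  rw [← Set.encard_coe_eq_coe_finsetCard]
  refine Set.encard_le_encard_of_injOn (f := f) (fun x hx => hfC x hx) ?_
  intro x hx y hy hxy
  by_contra hne
  have h2 : edist x y ≤ ENNReal.ofReal r :=
    (Metric.edist_le_ediam_of_mem (hf x hx) (hxy ▸ hf y hy)).trans (hC.1 _ (hfC x hx))
  rw [edist_dist, ENNReal.ofReal_le_ofReal_iff hr] at h2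
  exact (hsep x hx y hy hne).not_ge h2

lemma coverNumber_le_card {M : Type*} [MetricSpace M] {r : ℝ} {F : Set M} {ι : Type*}
    (Q : Finset ι) (U : ι → Set M) (hU : ∀ i ∈ Q, Metric.ediam (U i) ≤ ENNReal.ofReal r)
    (hF : ∀ x ∈ F, ∃ i ∈ Q, x ∈ U i) : coverNumber r F ≤ Q.card := by
  refine (iInf₂_le (U '' (Q : Set ι)) ⟨?_, fun x hx => ?_⟩).trans
    ((Set.encard_image_le _ _).trans_eq (Set.encard_coe_eq_coe_finsetCard Q))
  · rintro _ ⟨i, hi, rfl⟩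
    exact hU i hi
  · obtain ⟨i, hi, hxi⟩ := hF x hx
    exact ⟨U i, ⟨i, hi, rfl⟩, hxi⟩

lemma exists_separated_net {α M : Type*} [MetricSpace M] (f : α → M) (r : ℝ) (hr : 0 ≤ r)
    (A : Finset α) : ∃ Q ⊆ A, (∀ q ∈ Q, ∀ q' ∈ Q, q ≠ q' → r < dist (f q) (f q')) ∧
      ∀ a ∈ A, ∃ q ∈ Q, dist (f a) (f q) ≤ r := by
  classical
  induction A using Finset.induction_on with
  | empty => exact ⟨∅, le_rfl, by simp, by simp⟩
  | insert a A ha ih =>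
    obtain ⟨Q, hQA, hsep, hnet⟩ := ih
    by_cases h : ∃ q ∈ Q, dist (f a) (f q) ≤ r
    · refine ⟨Q, hQA.trans (Finset.subset_insert _ _), hsep, fun b hb => ?_⟩
      rcases Finset.mem_insert.1 hb with rfl | hb
      · exact h
      · exact hnet b hb
    · push Not at h
      refine ⟨insert a Q, Finset.insert_subset_insert _ hQA, ?_, fun b hb => ?_⟩
      · intro q hq q' hq' hne
        rcases Finset.mem_insert.1 hq with rfl | hqQ <;>
          rcases Finset.mem_insert.1 hq' with rfl | hqQ'
        · exact absurd rfl hne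
        · exact h q' hqQ'
        · rw [dist_comm]
          exact h q hqQ
        · exact hsep q hqQ q' hqQ' hne
      · rcases Finset.mem_insert.1 hb with rfl | hb
        · exact ⟨b, Finset.mem_insert_self _ _, by rwa [dist_self]⟩
        · obtain ⟨q, hq, hbq⟩ := hnet b hb
          exact ⟨q, Finset.mem_insert_of_mem hq, hbq⟩

lemma tendsto_log_mul_rpow_div (c q : ℝ) (hc : 0 < c) :
    Tendsto (fun r : ℝ => Real.log (c * r ^ (-q)) / -Real.log r) (𝓝[>] 0) (𝓝 q) := by
  have h1 : Tendsto (fun r : ℝ => -Real.log r) (𝓝[>] 0) atTop :=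
    tendsto_neg_atBot_atTop.comp Real.tendsto_log_nhdsGT_zero
  have h2 : Tendsto (fun r : ℝ => Real.log c / -Real.log r + q) (𝓝[>] 0) (𝓝 (0 + q)) :=
    (tendsto_const_nhds.div_atTop h1).add_const q
  rw [zero_add] at h2
  refine h2.congr' ?_
  filter_upwards [h1.eventually_gt_atTop 0, self_mem_nhdsWithin] with r hr hr0
  have hr0' : (0 : ℝ) < r := hr0
  rw [Real.log_mul hc.ne' (Real.rpow_pos_of_pos hr0' _).ne', Real.log_rpow hr0']
  have : Real.log r ≠ 0 := by linarith
  field_simp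
  ring

/-- Constants disappear after dividing logarithms by -log r. In the upper bound it suffices to have
exponents q arbitrarily close to κ, so no bound at κ itself is needed. -/
lemma hasBoxDim_of_bounds {M : Type*} [MetricSpace M] {F : Set M} {κ : ℝ}
    (hlow : ∃ c : ℝ, 0 < c ∧
      ∀ᶠ r in 𝓝[>] (0 : ℝ), ENNReal.ofReal (c * r ^ (-κ)) ≤ (coverNumber r F : ENNReal))
    (hup : ∀ a, κ < a → ∃ q < a, ∃ C : ℝ, 0 < C ∧
      ∀ᶠ r in 𝓝[>] (0 : ℝ), (coverNumber r F : ENNReal) ≤ ENNReal.ofReal (C * r ^ (-q))) :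
    HasBoxDim F (κ : EReal) := by
  have h1 : ∀ᶠ r in 𝓝[>] (0 : ℝ), 0 < r ∧ 0 < -Real.log r :=
    (eventually_mem_nhdsWithin).and
      ((tendsto_neg_atBot_atTop.comp Real.tendsto_log_nhdsGT_zero).eventually_gt_atTop 0)
  have hval : ∀ c q r : ℝ, 0 < c → 0 < r →
      ENNReal.log (ENNReal.ofReal (c * r ^ (-q))) / ((-Real.log r : ℝ) : EReal) =
        ((Real.log (c * r ^ (-q)) / -Real.log r : ℝ) : EReal) := by
    intro c q r hc hr
    rw [ENNReal.log_ofReal_of_pos (by positivity), EReal.coe_div]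
  have ht : Tendsto (boxRatio F) (𝓝[>] 0) (𝓝 (κ : EReal)) := by
    refine tendsto_order.2 ⟨fun a ha => ?_, fun a ha => ?_⟩
    · obtain ⟨c, hc, hlow⟩ := hlow
      have h2 := (continuous_coe_real_ereal.tendsto κ).comp (tendsto_log_mul_rpow_div c κ hc)
      filter_upwards [h2.eventually (lt_mem_nhds ha), hlow, h1] with r hr hle ⟨hr0, hr1⟩
      refine hr.trans_le ?_
      rw [Function.comp_apply, ← hval c κ r hc hr0]
      exact EReal.div_le_div_right_of_nonneg (by exact_mod_cast hr1.le) (ENNReal.log_monotone hle)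
    · obtain ⟨b, hκb, hba⟩ := EReal.lt_iff_exists_real_btwn.1 ha
      obtain ⟨q, hq, C, hC, hup⟩ := hup b (by exact_mod_cast hκb)
      have h2 := (continuous_coe_real_ereal.tendsto q).comp (tendsto_log_mul_rpow_div C q hC)
      have hqa : (q : EReal) < a := lt_trans (by exact_mod_cast hq) hba
      filter_upwards [h2.eventually (gt_mem_nhds hqa), hup, h1] with r hr hle ⟨hr0, hr1⟩
      refine lt_of_le_of_lt ?_ hr
      rw [Function.comp_apply, ← hval C q r hC hr0]
      exact EReal.div_le_div_right_of_nonneg (by exact_mod_cast hr1.le) (ENNReal.log_monotone hle)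
  exact ⟨ht.liminf_eq, ht.limsup_eq⟩

/-- The terms are comparable to (1 + y)^(-2s), which gives convergence for 2s > k. For 0 ≤ s < k/2
the elements with y ≤ A + R contribute at least a constant times R^(k - 2s), which is unbounded.
Positivity of k matters: a finite group has exponent -∞. -/
lemma criticalExponent_eq_of_growth {n : ℕ} {P : Subgroup (HypSpace n ≃ᵢ HypSpace n)}
    (o : HypSpace n) {k : ℕ} (hk : 0 < k) {y : P → ℝ} {C A c : ℝ} (hC : 0 < C) (hA : 0 ≤ A)
    (hc : 0 < c) (hy : ∀ p, 0 ≤ y p)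
    (hexp : ∀ p, Real.exp (dist o (p.1 o) / 2) ≤ C * (1 + y p) ∧
      1 + y p ≤ C * Real.exp (dist o (p.1 o) / 2))
    (hsum : ∀ s : ℝ, k < s → Summable fun p => (1 + y p) ^ (-s))
    (hcount : ∀ R : ℝ, 0 ≤ R → ∃ T : Finset P, c * R ^ k ≤ T.card ∧ ∀ p ∈ T, y p ≤ A + R) :
    criticalExponent o P = ((k / 2 : ℝ) : EReal) := by
  have hexp_eq : ∀ (s : ℝ) (p : P), Real.exp (-s * dist o (p.1 o)) =
      Real.exp (dist o (p.1 o) / 2) ^ (-(2 * s)) := by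
    intro s p
    rw [← Real.exp_mul]
    congr 1
    ring
  have hconv : ∀ s : ℝ, (k / 2 : ℝ) < s →
      Summable fun p : P => Real.exp (-s * dist o (p.1 o)) := by
    intro s hs
    have hk0 : (0 : ℝ) < k := by exact_mod_cast hk
    refine ((hsum (2 * s) (by linarith)).mul_left (C ^ (2 * s))).of_nonneg_of_le
      (fun p => (Real.exp_pos _).le) fun p => ?_
    have h1 : (1 + y p) / C ≤ Real.exp (dist o (p.1 o) / 2) := by
      rw [div_le_iff₀ hC, mul_comm]
      exact (hexp p).2
    have h2 := hy p
    rw [hexp_eq]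
    calc Real.exp (dist o (p.1 o) / 2) ^ (-(2 * s)) ≤ ((1 + y p) / C) ^ (-(2 * s)) :=
          Real.rpow_le_rpow_of_nonpos (by positivity) h1 (by linarith)
      _ = C ^ (2 * s) * (1 + y p) ^ (-(2 * s)) := by
          rw [Real.div_rpow (by positivity) hC.le, Real.rpow_neg hC.le, div_inv_eq_mul, mul_comm]
  have hdiv : ∀ s : ℝ, Summable (fun p : P => Real.exp (-s * dist o (p.1 o))) →
      (k / 2 : ℝ) ≤ s := by
    intro s hs
    by_contra! hlt
    have hk0 : (0 : ℝ) < k := by exact_mod_cast hk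
    -- A negative s is replaced by 0, still below k/2, so that the terms decrease with the distance.
    set s' := max s 0 with hs'
    have hs'0 : 0 ≤ s' := le_max_right _ _
    have hs'k : s' < k / 2 := max_lt hlt (by positivity)
    have hsum' : Summable fun p : P => Real.exp (-s' * dist o (p.1 o)) := by
      refine hs.of_nonneg_of_le (fun p => (Real.exp_pos _).le) fun p => ?_
      rw [Real.exp_le_exp]
      have := le_max_left s 0
      have h2 := dist_nonneg (x := o) (y := p.1 o)
      nlinarith
    set B := ∑' p : P, Real.exp (-s' * dist o (p.1 o)) with hB
    set D := C * (2 + A) with hD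
    have hD0 : 0 < D := by positivity
    have hbd : ∀ R : ℝ, 1 ≤ R → c * D ^ (-(2 * s')) * R ^ ((k : ℝ) - 2 * s') ≤ B := by
      intro R hR
      obtain ⟨T, hT, hTR⟩ := hcount R (by linarith)
      have h1 : ∀ p ∈ T, (D * R) ^ (-(2 * s')) ≤ Real.exp (-s' * dist o (p.1 o)) := by
        intro p hp
        rw [hexp_eq]
        refine Real.rpow_le_rpow_of_nonpos (Real.exp_pos _) ((hexp p).1.trans ?_) (by linarith)
        rw [hD, mul_assoc]
        have := hTR p hp
        gcongr
        nlinarith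
      calc c * D ^ (-(2 * s')) * R ^ ((k : ℝ) - 2 * s')
          = c * R ^ k * (D * R) ^ (-(2 * s')) := by
            rw [Real.mul_rpow hD0.le (by linarith), sub_eq_add_neg, Real.rpow_add (by linarith),
              Real.rpow_natCast]
            ring
        _ ≤ T.card * (D * R) ^ (-(2 * s')) := by gcongr
        _ = ∑ p ∈ T, (D * R) ^ (-(2 * s')) := by rw [Finset.sum_const, nsmul_eq_mul]
        _ ≤ ∑ p ∈ T, Real.exp (-s' * dist o (p.1 o)) := Finset.sum_le_sum h1
        _ ≤ B := hsum'.sum_le_tsum _ fun p _ => (Real.exp_pos _).le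
    have ht : Tendsto (fun R : ℝ => c * D ^ (-(2 * s')) * R ^ ((k : ℝ) - 2 * s')) atTop atTop :=
      (tendsto_rpow_atTop (by linarith)).const_mul_atTop (by positivity)
    obtain ⟨R, hR1, hR2⟩ := ((ht.eventually_gt_atTop B).and (eventually_ge_atTop 1)).exists
    exact hR1.not_ge (hbd R hR2)
  refine IsGLB.sInf_eq ⟨?_, fun b hb => ?_⟩
  · rintro _ ⟨s, hs, rfl⟩
    exact EReal.coe_le_coe_iff.2 (hdiv s hs)
  · by_contra! hlt
    obtain ⟨s, h1, h2⟩ := EReal.lt_iff_exists_real_btwn.1 hlt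
    exact (hb ⟨s, hconv s (by exact_mod_cast h1), rfl⟩).not_gt h2

end BoxCounting

/-! ### Covering numbers of the orbit. -/

section Orbit

variable {n : ℕ}

namespace HypBoundary

lemma cos_dist (ξ η : HypBoundary n) : Real.cos (dist ξ η) = 1 - dist ξ.pt η.pt ^ 2 / 2 := by
  rw [dist_def, InnerProductGeometry.cos_angle, ξ.norm_eq, η.norm_eq, dist_pt_sq]
  ring

lemma dist_pt_le_dist (ξ η : HypBoundary n) : dist ξ.pt η.pt ≤ dist ξ η := by
  have h1 := Real.one_sub_sq_div_two_le_cos (x := dist ξ η)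
  rw [cos_dist] at h1
  refine le_of_sq_le_sq ?_ dist_nonneg
  linarith

lemma dist_le_two_mul_dist_pt (ξ η : HypBoundary n) : dist ξ η ≤ 2 * dist ξ.pt η.pt := by
  have hpi : dist ξ η ≤ Real.pi := InnerProductGeometry.angle_le_pi _ _
  have h1 := Real.cos_le_one_sub_mul_cos_sq (x := dist ξ η) (by
    rwa [abs_of_nonneg dist_nonneg])
  rw [cos_dist] at h1
  have h2 : (1 / 8 : ℝ) ≤ 2 / Real.pi ^ 2 := by
    rw [div_le_div_iff₀ (by norm_num) (by positivity)]
    nlinarith [Real.pi_pos, Real.pi_le_four]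
  refine le_of_sq_le_sq ?_ (by positivity)
  nlinarith [sq_nonneg (dist ξ η)]

/-- One factor 2 comes from the triangle inequality, the other from replacing chords by angles. -/
lemma ediam_setOf_dist_pt_le (ζ : HypBoundary n) {ρ r : ℝ} (h : 4 * ρ ≤ r) :
    Metric.ediam {η : HypBoundary n | dist η.pt ζ.pt ≤ ρ} ≤ ENNReal.ofReal r := by
  refine Metric.ediam_le fun η hη η' hη' => ?_
  rw [edist_dist]
  refine ENNReal.ofReal_le_ofReal ?_
  have h1 := dist_le_two_mul_dist_pt η η'
  have h2 := dist_triangle_right η.pt η'.pt ζ.pt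
  have h3 : dist η.pt ζ.pt ≤ ρ := hη
  have h4 : dist η'.pt ζ.pt ≤ ρ := hη'
  linarith

lemma dist_pt_sq_eq {w ξ η : HypBoundary n} (hξ : ξ ≠ w) (hη : η ≠ w) :
    dist ξ.pt η.pt ^ 2 = 16 * ‖stereo w ξ - stereo w η‖ ^ 2 /
      ((‖stereo w ξ‖ ^ 2 + 4) * (‖stereo w η‖ ^ 2 + 4)) := by
  have := dist_stereoInv_sq w (stereo w ξ) (stereo w η)
  rwa [stereoInv_stereo hξ, stereoInv_stereo hη] at this

lemma dist_pt_le {w ξ η : HypBoundary n} (hξ : ξ ≠ w) (hη : η ≠ w) :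
    dist ξ.pt η.pt ≤ 16 * ‖stereo w ξ - stereo w η‖ /
      ((1 + ‖stereo w ξ‖) * (1 + ‖stereo w η‖)) := by
  refine le_of_sq_le_sq ?_ (by positivity)
  rw [dist_pt_sq_eq hξ hη, div_pow, mul_pow, mul_pow]
  have key : ∀ t : ℝ, (1 + t) ^ 2 / 4 ≤ t ^ 2 + 4 := fun t => by nlinarith [sq_nonneg (3 * t - 1)]
  have h1 := key ‖stereo w ξ‖
  have h2 := key ‖stereo w η‖
  calc 16 * ‖stereo w ξ - stereo w η‖ ^ 2 / ((‖stereo w ξ‖ ^ 2 + 4) * (‖stereo w η‖ ^ 2 + 4))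
      ≤ 16 * ‖stereo w ξ - stereo w η‖ ^ 2 /
        ((1 + ‖stereo w ξ‖) ^ 2 / 4 * ((1 + ‖stereo w η‖) ^ 2 / 4)) := by gcongr
    _ = 16 ^ 2 * ‖stereo w ξ - stereo w η‖ ^ 2 /
        ((1 + ‖stereo w ξ‖) ^ 2 * (1 + ‖stereo w η‖) ^ 2) := by field_simp; norm_num; ring

lemma dist_pt_pole_le {w ξ : HypBoundary n} (hξ : ξ ≠ w) :
    dist ξ.pt w.pt ≤ 8 / (1 + ‖stereo w ξ‖) := by
  refine le_of_sq_le_sq ?_ (by positivity)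
  have h := dist_stereoInv_self_sq w (stereo w ξ)
  rw [stereoInv_stereo hξ] at h
  rw [h, div_pow, div_le_div_iff₀ (by positivity) (by positivity)]
  nlinarith [sq_nonneg (3 * ‖stereo w ξ‖ - 1)]

lemma le_dist_pt {w ξ η : HypBoundary n} (hξ : ξ ≠ w) (hη : η ≠ w) {B : ℝ} (hB : 2 ≤ B)
    (hξB : ‖stereo w ξ‖ ≤ B) (hηB : ‖stereo w η‖ ≤ B) :
    2 * ‖stereo w ξ - stereo w η‖ / B ^ 2 ≤ dist ξ.pt η.pt := by
  refine le_of_sq_le_sq ?_ dist_nonneg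
  rw [dist_pt_sq_eq hξ hη, div_pow, mul_pow]
  have key : ∀ t : ℝ, 0 ≤ t → t ≤ B → t ^ 2 + 4 ≤ 2 * B ^ 2 := fun t ht h => by nlinarith
  have h1 := key _ (norm_nonneg _) hξB
  have h2 := key _ (norm_nonneg _) hηB
  calc 2 ^ 2 * ‖stereo w ξ - stereo w η‖ ^ 2 / (B ^ 2) ^ 2
      = 16 * ‖stereo w ξ - stereo w η‖ ^ 2 / ((2 * B ^ 2) * (2 * B ^ 2)) := by
        field_simp; norm_num; ring
    _ ≤ _ := by gcongr

end HypBoundary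

open HypBoundary

/-- The orbit is bounded from below in size by the growth of the group. -/
lemma exists_le_coverNumber {P : Subgroup (HypSpace n ≃ᵢ HypSpace n)} {w ξ : HypBoundary n}
    (hξ : ∀ p : P, p.1 • ξ ≠ w) {k : ℕ} {c : ℝ} (hc : 0 < c)
    (hinv : ∀ p q : P, ‖stereo w (p.1 • ξ) - stereo w (q.1 • ξ)‖ =
      ‖stereo w ((p⁻¹ * q).1 • ξ) - stereo w ξ‖)
    (hfin : ∀ R : ℝ, {p : P | ‖stereo w (p.1 • ξ) - stereo w ξ‖ ≤ R}.Finite)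
    (hcount : ∀ R : ℝ, 0 ≤ R → ∃ T : Finset P, c * R ^ k ≤ T.card ∧
      ∀ p ∈ T, ‖stereo w (p.1 • ξ) - stereo w ξ‖ ≤ R) :
    ∃ c' : ℝ, 0 < c' ∧ ∀ᶠ r in 𝓝[>] (0 : ℝ), ENNReal.ofReal (c' * r ^ (-(k / 2 : ℝ))) ≤
      (coverNumber r (⋃ p ∈ P, {p • ξ}) : ENNReal) := by
  classical
  set x := stereo w ξ with hx
  -- Only finitely many elements keep ξ within distance 1 of x in coordinates, so the nonzero
  -- displacements have a positive lower bound.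
  obtain ⟨δ, hδ0, hδ⟩ : ∃ δ : ℝ, 0 < δ ∧
      ∀ p : P, stereo w (p.1 • ξ) ≠ x → δ ≤ ‖stereo w (p.1 • ξ) - x‖ := by
    set Z := (fun p : P => ‖stereo w (p.1 • ξ) - x‖) ''
      {p : P | ‖stereo w (p.1 • ξ) - x‖ ≤ 1} \ {0} with hZ
    have h1 : Zᶜ ∈ 𝓝 (0 : ℝ) := (((hfin 1).image _).subset
      Set.sdiff_subset).isClosed.isOpen_compl.mem_nhds fun h => h.2 rfl
    obtain ⟨ε, hε, hball⟩ := Metric.mem_nhds_iff.1 h1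
    refine ⟨min ε 1, by positivity, fun p hp => ?_⟩
    by_contra! hlt
    have h2 : ‖stereo w (p.1 • ξ) - x‖ ∈ Metric.ball (0 : ℝ) ε := by
      rw [Metric.mem_ball, dist_zero_right, norm_norm]
      exact hlt.trans_le (min_le_left _ _)
    refine hball h2 ⟨⟨p, hlt.le.trans (min_le_right _ _), rfl⟩, ?_⟩
    exact fun h => hp (sub_eq_zero.1 (norm_eq_zero.1 h))
  -- M is the order of the stabilizer of ξ, the multiplicity with which group elements count orbit
  -- points.
  obtain ⟨M, hM⟩ : ∃ M, M = (hfin 0).toFinset.card := ⟨_, rfl⟩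
  have hM0 : 0 < M := hM ▸ Finset.card_pos.2 ⟨1, by simp [hx]⟩
  have hM0' : (0 : ℝ) < M := by exact_mod_cast hM0
  set A := ‖x‖ + 2 with hA
  have hA0 : 0 < A := by positivity
  set D := δ / A ^ 2 with hD
  have hD0 : 0 < D := by positivity
  refine ⟨c * D ^ (k / 2 : ℝ) / M,
    div_pos (mul_pos hc (Real.rpow_pos_of_pos hD0 _)) hM0', ?_⟩
  filter_upwards [Ioo_mem_nhdsGT hD0] with r hr
  have hr0 : 0 < r := hr.1
  -- With this radius (AR)² = δ/r, so `le_dist_pt` separates distinct points by 2δ/(AR)² = 2r > r.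
  set R := √(D / r) with hR
  have hR2 : R ^ 2 = D / r := Real.sq_sqrt (by positivity)
  have hR1 : 1 ≤ R := by
    rw [hR, Real.one_le_sqrt, one_le_div hr0]
    exact hr.2.le
  have hRk : R ^ k = D ^ (k / 2 : ℝ) * r ^ (-(k / 2 : ℝ)) := by
    rw [hR, Real.sqrt_eq_rpow, ← Real.rpow_natCast, ← Real.rpow_mul (by positivity),
      one_div_mul_eq_div, Real.div_rpow hD0.le hr0.le, Real.rpow_neg hr0.le, div_eq_mul_inv]
  obtain ⟨T, hT, hTR⟩ := hcount R (by linarith)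
  set Q := T.image fun p => p.1 • ξ with hQ
  have hcard : T.card ≤ M * Q.card := by
    refine Finset.card_le_mul_card_image _ _ fun η hη => ?_
    obtain ⟨p, hp, rfl⟩ := Finset.mem_image.1 hη
    rw [← Finset.card_image_of_injective _ (mul_right_injective p⁻¹), hM]
    refine Finset.card_le_card fun q hq => ?_
    obtain ⟨q, hqT, rfl⟩ := Finset.mem_image.1 hq
    have e : q.1 • ξ = p.1 • ξ := (Finset.mem_filter.1 hqT).2
    rw [Set.Finite.mem_toFinset]
    change ‖_‖ ≤ (0 : ℝ)
    rw [← hinv p q, e, sub_self, norm_zero]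
  have hcov : (Q.card : ℕ∞) ≤ coverNumber r (⋃ p ∈ P, {p • ξ}) := by
    refine card_le_coverNumber hr0.le Q (fun η hη => ?_) fun η hη η' hη' hne => ?_
    · obtain ⟨p, -, rfl⟩ := Finset.mem_image.1 hη
      exact Set.mem_biUnion p.2 rfl
    · obtain ⟨p, hp, rfl⟩ := Finset.mem_image.1 hη
      obtain ⟨q, hq, rfl⟩ := Finset.mem_image.1 hη'
      have hbound : ∀ p ∈ T, ‖stereo w (p.1 • ξ)‖ ≤ A * R := fun p hp => by
        have h1 := norm_sub_norm_le (stereo w (p.1 • ξ)) x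
        have h2 := hTR p hp
        nlinarith [norm_nonneg x]
      have h3 := le_dist_pt (hξ p) (hξ q) (B := A * R) (by nlinarith [norm_nonneg x])
        (hbound p hp) (hbound q hq)
      have h4 : δ ≤ ‖stereo w (p.1 • ξ) - stereo w (q.1 • ξ)‖ := by
        rw [hinv]
        refine hδ _ fun h => hne ?_
        have h5 := hinv p q
        rw [h, sub_self, norm_zero, norm_eq_zero, sub_eq_zero] at h5
        rw [← stereoInv_stereo (hξ p), h5, stereoInv_stereo (hξ q)]
      refine lt_of_lt_of_le ?_ (h3.trans (dist_pt_le_dist _ _))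
      rw [lt_div_iff₀ (by positivity), mul_pow, hR2, hD]
      have e : r * (A ^ 2 * (δ / A ^ 2 / r)) = δ := by field_simp
      linarith
  have h6 : c * D ^ (k / 2 : ℝ) / M * r ^ (-(k / 2 : ℝ)) ≤ Q.card := by
    rw [div_mul_eq_mul_div, div_le_iff₀ hM0', mul_assoc, ← hRk, mul_comm _ (M : ℝ)]
    exact hT.trans (by exact_mod_cast hcard)
  calc ENNReal.ofReal (c * D ^ (k / 2 : ℝ) / M * r ^ (-(k / 2 : ℝ)))
      ≤ ENNReal.ofReal Q.card := ENNReal.ofReal_le_ofReal h6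
    _ = ((Q.card : ℕ∞) : ENNReal) := by rw [ENNReal.ofReal_natCast, ENat.toENNReal_coe]
    _ ≤ _ := ENat.toENNReal_le.2 hcov

/-- The orbit is bounded from above in size by the growth of the group. -/
lemma exists_coverNumber_le {P : Subgroup (HypSpace n ≃ᵢ HypSpace n)} {w ξ : HypBoundary n}
    (hξ : ∀ p : P, p.1 • ξ ≠ w) {k : ℕ} {c : ℝ} (hc : 0 < c)
    (hinv : ∀ p q : P, ‖stereo w (p.1 • ξ) - stereo w (q.1 • ξ)‖ =
      ‖stereo w ((p⁻¹ * q).1 • ξ) - stereo w ξ‖)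
    (hfin : ∀ R : ℝ, {p : P | ‖stereo w (p.1 • ξ) - stereo w ξ‖ ≤ R}.Finite)
    (hcount : ∀ R : ℝ, 0 ≤ R → ∃ T : Finset P, c * R ^ k ≤ T.card ∧
      ∀ p ∈ T, ‖stereo w (p.1 • ξ) - stereo w ξ‖ ≤ R)
    (hsum : ∀ s : ℝ, k < s → Summable fun p : P => (1 + ‖stereo w (p.1 • ξ)‖) ^ (-s))
    {q : ℝ} (hkq : (k / 2 : ℝ) < q) (hqk : q ≤ k) :
    ∃ C : ℝ, 0 < C ∧ ∀ᶠ r in 𝓝[>] (0 : ℝ), (coverNumber r (⋃ p ∈ P, {p • ξ}) : ENNReal) ≤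
      ENNReal.ofReal (C * r ^ (-q)) := by
  classical
  have hk0 : (0 : ℝ) ≤ k := by positivity
  have hq0 : 0 < q := by linarith
  set y : P → (ℝ ∙ w.pt)ᗮ := fun p => stereo w (p.1 • ξ) with hy
  set X : P → ℝ := fun p => 1 + ‖y p‖ with hX
  have hX1 : ∀ p, 1 ≤ X p := fun p => le_add_of_nonneg_right (norm_nonneg _)
  have hX0 : ∀ p, 0 < X p := fun p => zero_lt_one.trans_le (hX1 p)
  have hsum := hsum (2 * q) (by linarith)
  change Summable fun p => X p ^ (-(2 * q)) at hsum
  set W := ∑' p, X p ^ (-(2 * q)) with hW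
  have hW0 : 0 ≤ W := tsum_nonneg fun p => (Real.rpow_pos_of_pos (hX0 p) _).le
  -- The exponent q serves all radii at once: for R ≤ 1 the identity is enough since R^q ≤ 1, and
  -- for R ≥ 1 the bound q ≤ k gives R^q ≤ R^k.
  set c₁ := min c 1 with hc₁
  have hc₁0 : 0 < c₁ := by positivity
  have hcount' : ∀ R : ℝ, 0 ≤ R → ∃ T : Finset P, c₁ * R ^ q ≤ T.card ∧
      ∀ p ∈ T, ‖y p - stereo w ξ‖ ≤ R := by
    intro R hR
    rcases le_total R 1 with h1 | h1
    · refine ⟨{1}, ?_, fun p hp => ?_⟩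
      · rw [Finset.card_singleton, Nat.cast_one]
        exact mul_le_one₀ (min_le_right _ _) (by positivity) (Real.rpow_le_one hR h1 hq0.le)
      · rw [Finset.mem_singleton.1 hp]
        simpa [hy] using hR
    · obtain ⟨T, hT, hTR⟩ := hcount R hR
      refine ⟨T, le_trans ?_ hT, hTR⟩
      have h2 : R ^ q ≤ R ^ k := by
        rw [← Real.rpow_natCast]
        exact Real.rpow_le_rpow_of_exponent_le h1 hqk
      exact mul_le_mul (min_le_left _ _) h2 (by positivity) hc.le
  set m := c₁ * 2 ^ (-(2 * q)) * (1 / 512) ^ q with hm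
  have hm0 : 0 < m := by positivity
  refine ⟨W / m + 1, by positivity, ?_⟩
  filter_upwards [Ioo_mem_nhdsGT zero_lt_one] with r hr
  have hr0 : 0 < r := hr.1
  -- Caps of chordal radius 64t then have angular diameter at most 256t = r/2.
  set t := r / 512 with ht
  have ht0 : 0 < t := by positivity
  have hAfin : {p : P | t * X p ≤ 1 / 2}.Finite := by
    refine (hfin (1 / (2 * t) + ‖stereo w ξ‖)).subset fun p hp => ?_
    have h1 : t * X p ≤ 1 / 2 := hp
    have h2 : X p ≤ 1 / (2 * t) := by
      rw [le_div_iff₀ (by positivity)]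
      linarith
    refine (norm_sub_le _ _).trans ?_
    change ‖y p‖ + _ ≤ _
    have h3 : X p = 1 + ‖y p‖ := rfl
    linarith
  obtain ⟨Q, hQA, hsep, hnet⟩ := exists_separated_net (fun p : P => (p.1 • ξ).pt) (64 * t)
    (by positivity) hAfin.toFinset
  -- A Euclidean radius t X² at y corresponds to a chordal radius of order t, whatever the size of
  -- y. By homogeneity the ball contains as many elements as the one around the identity.
  have hball : ∀ p : P, ∃ B : Finset P, c₁ * (t * X p ^ 2) ^ q ≤ B.card ∧
      ∀ p' ∈ B, ‖y p - y p'‖ ≤ t * X p ^ 2 := by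
    intro p
    obtain ⟨T, hT, hTR⟩ := hcount' (t * X p ^ 2) (by have := hX0 p; positivity)
    refine ⟨T.image fun g => p * g, ?_, fun p' hp' => ?_⟩
    · rwa [Finset.card_image_of_injective _ (mul_right_injective p)]
    · obtain ⟨g, hg, rfl⟩ := Finset.mem_image.1 hp'
      have h1 := hinv p (p * g)
      rw [inv_mul_cancel_left] at h1
      exact h1.trans_le (hTR g hg)
  choose B hBcard hB using hball
  have hQt : ∀ p ∈ Q, t * X p ≤ 1 / 2 := fun p hp => by
    have := hQA hp
    rwa [Set.Finite.mem_toFinset] at this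
  have hcomp : ∀ p ∈ Q, ∀ p' ∈ B p, X p / 2 ≤ X p' ∧ X p' ≤ 2 * X p := by
    intro p hp p' hp'
    have h1 := hB p p' hp'
    have h2 : t * X p ^ 2 ≤ X p / 2 := by
      have := hQt p hp
      nlinarith [hX0 p]
    have h3 := norm_sub_norm_le (y p) (y p')
    have h4 := norm_sub_norm_le (y p') (y p)
    rw [norm_sub_rev] at h4
    have h5 : X p = 1 + ‖y p‖ := rfl
    have h6 : X p' = 1 + ‖y p'‖ := rfl
    have h7 := hX0 p
    constructor <;> linarith
  have hclose : ∀ p ∈ Q, ∀ p' ∈ B p, dist (p.1 • ξ).pt (p'.1 • ξ).pt ≤ 32 * t := by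
    intro p hp p' hp'
    refine (dist_pt_le (hξ p) (hξ p')).trans ?_
    have h1 : ‖stereo w (p.1 • ξ) - stereo w (p'.1 • ξ)‖ ≤ t * X p ^ 2 := hB p p' hp'
    have h2 := (hcomp p hp p' hp').1
    change 16 * _ / (X p * X p') ≤ _
    have h3 := hX0 p
    have h4 := hX0 p'
    rw [div_le_iff₀ (by positivity)]
    have h5 : t * X p * (X p / 2) ≤ t * X p * X p' := by gcongr
    nlinarith
  -- Each B p reaches a chordal distance of at most 32t from its centre, and the centres are more
  -- than 64t apart.
  have hdisj : (Q : Set P).PairwiseDisjoint B := by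
    intro p hp p' hp' hne
    rw [Function.onFun, Finset.disjoint_left]
    intro a ha ha'
    have h1 := hclose p hp a ha
    have h2 := hclose p' hp' a ha'
    have h3 := dist_triangle_right (p.1 • ξ).pt (p'.1 • ξ).pt (a.1 • ξ).pt
    have h4 := hsep p hp p' hp' hne
    linarith
  -- The powers X^(2q) from the count and X^(-2q) from the weight cancel, so the bound does not
  -- depend on p. The total mass W is finite because 2q > k.
  have hmass : ∀ p ∈ Q, m * r ^ q ≤ ∑ p' ∈ B p, X p' ^ (-(2 * q)) := by
    intro p hp
    have h3 := hX0 p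
    calc m * r ^ q = c₁ * (t * X p ^ 2) ^ q * (2 * X p) ^ (-(2 * q)) := by
          have e1 : (X p ^ 2) ^ q = X p ^ (2 * q) := by
            rw [← Real.rpow_natCast, ← Real.rpow_mul h3.le, Nat.cast_ofNat]
          have e2 : X p ^ (2 * q) * X p ^ (-(2 * q)) = 1 := by
            rw [← Real.rpow_add h3, add_neg_cancel, Real.rpow_zero]
          rw [Real.mul_rpow ht0.le (by positivity), Real.mul_rpow zero_le_two h3.le, e1, ht,
            div_eq_mul_one_div r, Real.mul_rpow hr0.le (by norm_num), hm]
          linear_combination (-(c₁ * r ^ q * (1 / 512) ^ q * 2 ^ (-(2 * q)))) * e2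
      _ ≤ (B p).card * (2 * X p) ^ (-(2 * q)) := by
          gcongr
          exact hBcard p
      _ = ∑ p' ∈ B p, (2 * X p) ^ (-(2 * q)) := by rw [Finset.sum_const, nsmul_eq_mul]
      _ ≤ ∑ p' ∈ B p, X p' ^ (-(2 * q)) := Finset.sum_le_sum fun p' hp' =>
          Real.rpow_le_rpow_of_nonpos (hX0 p') (hcomp p hp p' hp').2 (by linarith)
  have hQcard : (Q.card : ℝ) * (m * r ^ q) ≤ W := by
    calc (Q.card : ℝ) * (m * r ^ q) = ∑ p ∈ Q, m * r ^ q := by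
          rw [Finset.sum_const, nsmul_eq_mul]
      _ ≤ ∑ p ∈ Q, ∑ p' ∈ B p, X p' ^ (-(2 * q)) := Finset.sum_le_sum hmass
      _ = ∑ p' ∈ Q.biUnion B, X p' ^ (-(2 * q)) := (Finset.sum_biUnion hdisj).symm
      _ ≤ W := hsum.sum_le_tsum _ fun p _ => (Real.rpow_pos_of_pos (hX0 p) _).le
  have hcov : coverNumber r (⋃ p ∈ P, {p • ξ}) ≤ ((Q.card + 1 : ℕ) : ℕ∞) := by
    have h1 : (Finset.insertNone Q).card = Q.card + 1 := Finset.card_insertNone Q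
    rw [← h1]
    let U : Option P → Set (HypBoundary n) := fun i =>
      {η | dist η.pt (i.elim w fun p => p.1 • ξ).pt ≤ 64 * t}
    refine coverNumber_le_card (Finset.insertNone Q) U
      (fun i _ => ediam_setOf_dist_pt_le _ (by rw [ht]; linarith)) fun η hη => ?_
    obtain ⟨p, hp, rfl⟩ := Set.mem_iUnion₂.1 hη
    by_cases hpA : t * X ⟨p, hp⟩ ≤ 1 / 2
    · obtain ⟨a, ha, hpa⟩ := hnet ⟨p, hp⟩ (hAfin.mem_toFinset.2 hpA)
      exact ⟨some a, Finset.some_mem_insertNone.2 ha, hpa⟩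
    -- Points with tX > 1/2 are within 8/X < 16t of w, so the cap at w covers them all.
    · refine ⟨none, Finset.none_mem_insertNone, (dist_pt_pole_le (hξ ⟨p, hp⟩)).trans ?_⟩
      change 8 / X ⟨p, hp⟩ ≤ _
      have h2 := hX0 ⟨p, hp⟩
      rw [div_le_iff₀ h2]
      push Not at hpA
      linarith
  have hfinal : ((Q.card + 1 : ℕ) : ℝ) ≤ (W / m + 1) * r ^ (-q) := by
    have hrq : 0 < r ^ q := Real.rpow_pos_of_pos hr0 _
    have h1 : (1 : ℝ) ≤ r ^ (-q) :=
      Real.one_le_rpow_of_pos_of_le_one_of_nonpos hr0 hr.2.le (by linarith)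
    have h2 : (Q.card : ℝ) ≤ W / m * r ^ (-q) := by
      rw [Real.rpow_neg hr0.le, ← div_eq_mul_inv, div_div, le_div_iff₀ (by positivity)]
      exact hQcard
    push_cast
    linarith
  calc (coverNumber r (⋃ p ∈ P, {p • ξ}) : ENNReal) ≤ (((Q.card + 1 : ℕ) : ℕ∞) : ENNReal) :=
        ENat.toENNReal_le.2 hcov
    _ = ENNReal.ofReal ((Q.card + 1 : ℕ) : ℝ) := by
        rw [ENNReal.ofReal_natCast, ENat.toENNReal_coe]
    _ ≤ _ := ENNReal.ofReal_le_ofReal hfinal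

end Orbit

theorem theorem3p9 (n : ℕ) (P : Subgroup (HypSpace n ≃ᵢ HypSpace n)) (hdisc : DiscreteTopology P)
    (hpar : IsParabolic P) (ξ : HypBoundary n) (hξ : ∃ p ∈ P, p • ξ ≠ ξ) (o : HypSpace n) :
    HasBoxDim (⋃ p ∈ P, {p • ξ}) (criticalExponent o P) := by
  obtain ⟨w, hw, huniq⟩ := hpar
  have hξw : ξ ≠ w := by
    rintro rfl
    obtain ⟨p, hp, hne⟩ := hξ
    exact hne (hw p hp)
  have hs := HypBoundary.horoScale_eq_one hw huniq
  have hinf : Infinite P := HypBoundary.infinite_of_parabolic hw hs huniq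
  obtain ⟨θ, hθ⟩ := HypBoundary.exists_affine_action hw hs
  have hpξ : ∀ p : P, p.1 • ξ ≠ w := fun p => HypBoundary.smul_ne_of_fixed (hw p.1 p.2) hξw
  set x := HypBoundary.stereo w ξ with hx
  have hθx : ∀ p, θ p x = HypBoundary.stereo w (p.1 • ξ) := fun p => by
    rw [hθ, hx, HypBoundary.stereoInv_stereo hξw]
  obtain ⟨C, hC, hexp⟩ := HypBoundary.exists_exp_dist_bounds hw hs o hξw
  have hfin' : ∀ R : ℝ, {p : P | ‖θ p x‖ ≤ R}.Finite := by
    intro R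
    refine (finite_dist_le_of_discreteTopology P o (2 * (C * (1 + R)))).subset fun p hp => ?_
    have h1 := (hexp p.1 p.2).1
    rw [← hθx] at h1
    have h2 : ‖θ p x‖ ≤ R := hp
    have h3 := Real.add_one_le_exp (dist o (p.1 o) / 2)
    have h4 : C * (1 + ‖θ p x‖) ≤ C * (1 + R) := by gcongr
    change dist o (p.1 o) ≤ _
    linarith
  have hfin0 : ∀ R : ℝ, {p : P | ‖θ p 0‖ ≤ R}.Finite := by
    intro R
    refine (hfin' (R + ‖x‖)).subset fun p hp => ?_
    have h1 : ‖θ p x - θ p 0‖ = ‖x‖ := by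
      rw [← dist_eq_norm, AffineIsometryEquiv.dist_map, dist_zero_right]
    have h2 := norm_sub_norm_le (θ p x) (θ p 0)
    have h3 : ‖θ p 0‖ ≤ R := hp
    change ‖θ p x‖ ≤ _
    linarith
  obtain ⟨k, hsum, ⟨c, hc, hcount⟩, hk⟩ := exists_growth_of_hom θ hfin0 x
  have hk0 : 0 < k := Nat.pos_of_ne_zero fun h => not_finite_iff_infinite.2 hinf (hk h)
  have hfin : ∀ R : ℝ, {p : P | ‖θ p x - x‖ ≤ R}.Finite := fun R =>
    (hfin' (R + ‖x‖)).subset fun p hp => by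
      have h1 := norm_sub_norm_le (θ p x) x
      have h2 : ‖θ p x - x‖ ≤ R := hp
      change ‖θ p x‖ ≤ _
      linarith
  have hinv : ∀ p q : P, ‖θ p x - θ q x‖ = ‖θ (p⁻¹ * q) x - x‖ := by
    intro p q
    have e : θ p (θ (p⁻¹ * q) x) = θ q x := by
      rw [← mul_apply_apply, ← map_mul, mul_inv_cancel_left]
    rw [← e, norm_sub_rev, ← dist_eq_norm, AffineIsometryEquiv.dist_map, dist_eq_norm]
  simp only [hθx] at hsum hcount hfin hinv
  have hcrit : criticalExponent o P = ((k / 2 : ℝ) : EReal) := by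
    refine criticalExponent_eq_of_growth o hk0 (y := fun p => ‖HypBoundary.stereo w (p.1 • ξ)‖)
      hC (norm_nonneg x) hc (fun p => norm_nonneg _) (fun p => hexp p.1 p.2) hsum fun R hR => ?_
    obtain ⟨T, hT, hTR⟩ := hcount R hR
    refine ⟨T, hT, fun p hp => ?_⟩
    have h1 := norm_sub_norm_le (HypBoundary.stereo w (p.1 • ξ)) x
    have h2 := hTR p hp
    linarith
  rw [hcrit]
  refine hasBoxDim_of_bounds (exists_le_coverNumber hpξ hc hinv hfin hcount) fun a ha => ?_
  have hk0' : (0 : ℝ) < k := by exact_mod_cast hk0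
  -- Some q lies strictly between k/2 and the smaller of a and k because k is positive.
  obtain ⟨q, hq1, hq2⟩ := exists_between (lt_min ha (by linarith : (k / 2 : ℝ) < k))
  exact ⟨q, hq2.trans_le (min_le_left _ _), exists_coverNumber_le hpξ hc hinv hfin hcount hsum hq1
    (hq2.le.trans (min_le_right _ _))⟩
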